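/- **Setting.** Let $\Pi$ be a cell complex consisting of elementary squares of the lattice $\mathbb Z^2$ (together with their vertices and edges), simply connected, with vertex set $G\cup G^*$, where $G$ ($G^*$) consists of the vertices $(m,n)$ with $m+n$ even (odd). Two vertices of $G$ are *neighboring* if they are opposite corners of a square of $\Pi$; assume that any two vertices of $G$ are linked by a chain of neighboring ones. A vertex is *internal* if all four squares around it belong to $\Pi$; an internal $v=(m,n)\in G$ has the four neighbors $(m\pm1,n\pm1)$. *Rings.* To each $v\in G$ belong a signed inner radius $r_v$ and an outer radius $R_v$; once a center $k_v\in S^2$ is chosen, they give an inner circle $c_v$ of spherical radius $|r_v|$, run through counter-clockwise about $k_v$ if $r_v>0$ and clockwise if $r_v<0$, and a concentric counter-clockwise outer circle $C_v$ of radius $R_v$. We say that an oriented circle with center $k$ and signed radius $\rho$ passes through $p\in S^2$ with oriented normal $n$ ($n$ a unit tangent vector at $p$) if $k=\cos\rho\,p-\sin\rho\,n$; the direction of motion at $p$ is then $p\times n$. *Patterns.* Rings with radii $(r_v,R_v)_{v\in G}$ *build a generalized orthogonal ring pattern in $S^2$* if one can choose centers $k_v\in S^2$ $(v\in G)$ and,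 for every $w\in G^*$, a point $\ell_w\in S^2$ and a unit tangent vector $n_w$ at $\ell_w$ such that for each edge of $\Pi$ joining $w=(a,b)\in G^*$ and $v\in G$: the inner circle $c_v$ passes through $\ell_w$ with oriented normal $n_w$ if $v=(a-1,b)$, and $-n_w$ if $v=(a+1,b)$; the outer circle $C_v$ passes through $\ell_w$ with oriented normal $\ell_w\times n_w$ if $v=(a,b-1)$, and $-\ell_w\times n_w$ if $v=(a,b+1)$. That is, of two neighboring rings the outer circle of each intersects the inner circle of the other orthogonally, and at each point $\ell_w$ the two inner circles and the two outer circles touch, compatibly with their orientations. In particular every internal ring together with its four neighbors forms a ring flower. *Elliptic variables.* For $0<q\le1$ let $\operatorname{sn},\operatorname{cn},\operatorname{dn}$ be the Jacobi elliptic functions of modulus $q$, and $4K$, $4iK'$ their real and imaginary periods (for $q=1$: $\operatorname{sn}z=\tanh z$, $\operatorname{cn}z=\operatorname{dn}z=1/\cosh z$, $K'=\pi/2$). The radii $(r,R)$ of a ring are *given by* $(q,\beta)$, $\beta\in\mathbb R$, if $$q\cos r=\cos R,\qquad \cos r=\operatorname{sn}\beta,\quad \sin r=\operatorname{cn}\beta,\quad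 \sin R=\operatorname{dn}\beta .$$ For $\beta:G\to\mathbb R$ consider, at a vertex $v\in G$ with neighbors $v_k$, $\beta=\beta_v$, $\beta_k=\beta_{v_k}$, the equation $$\prod_{v_k\sim v}\frac{\operatorname{sn}\bigl(\tfrac{\beta-\beta_k+iK'}{2}\bigr)}{\operatorname{sn}\bigl(\tfrac{\beta+\beta_k+iK'}{2}\bigr)}=1.\qquad(*)$$ **Theorem.** (a) Let $(r_v,R_v)_{v\in G}$ be radii of spherical rings, i.e. for every $v$ either $|r_v|<R_v<\frac\pi2$, or $\frac\pi2<R_v<|r_v|\le\pi$ (such a ring described from the antipodal center). The rings build a generalized orthogonal ring pattern in $S^2$ if and only if there are $q\in(0,1)$ and $\beta:G\to[0,4K]$ such that $(r_v,R_v)$ is given by $(q,\beta_v)$ for all $v\in G$ and $(*)$ holds at every internal vertex $v\in G$. (b) Let $0<q\le1$ and $\beta:G\to\mathbb R$, and let $(r_v,R_v)$ be radii given by $(q,\beta_v)$ for all $v\in G$. Rings with these radii build a generalized orthogonal ring pattern in $S^2$ if and only if $(*)$ holds at every internal vertex $v\in G$. -/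

import Mathlib

open scoped Matrix

noncomputable section

/-! ### Jacobi elliptic functions -/

/-- The incomplete elliptic integral of the first kind, with modulus `q`. -/
def ellipticF (q φ : ℝ) : ℝ := ∫ t in (0 : ℝ)..φ, 1 / Real.sqrt (1 - q ^ 2 * Real.sin t ^ 2)

/-- The complete elliptic integral `K(q)` (a quarter of the real period, for `0 ≤ q < 1`). -/
def ellipticK (q : ℝ) : ℝ := ellipticF q (Real.pi / 2)

/-- The complementary modulus `q' = √(1 - q²)`. -/
def compModulus (q : ℝ) : ℝ := Real.sqrt (1 - q ^ 2)

/-- `K'(q) = K(q')`. -/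
def ellipticK' (q : ℝ) : ℝ := ellipticK (compModulus q)

/-- Jacobi's amplitude function `am(u, q)` on the real line, for `0 ≤ q ≤ 1`. For `q < 1` it is
the inverse of the increasing bijection `φ ↦ F(φ, q)` of `ℝ`. For `q = 1` the integral `F(φ, 1)`
maps `(-π/2, π/2)` bijectively onto `ℝ`, and the inverse is the Gudermannian function
`u ↦ arcsin (tanh u)`. -/
def jacobiAm (q u : ℝ) : ℝ :=
  if q = 1 then Real.arcsin (Real.tanh u) else Function.invFun (ellipticF q) u

/-- `sn(u, q)` for real `u`. -/
def realSn (q u : ℝ) : ℝ := Real.sin (jacobiAm q u)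

/-- `cn(u, q)` for real `u`. -/
def realCn (q u : ℝ) : ℝ := Real.cos (jacobiAm q u)

/-- `dn(u, q)` for real `u`. -/
def realDn (q u : ℝ) : ℝ := Real.sqrt (1 - q ^ 2 * realSn q u ^ 2)

/-- `sn(z, q)` for complex `z = x + i y`, `0 ≤ q ≤ 1`, through Jacobi's imaginary transformation
`sn(i y, q) = i sn(y, q') / cn(y, q')` and the addition theorem:
`sn(x + i y) = (s d₁ + i c d s₁ c₁) / (c₁² + q² s² s₁²)`, where `s, c, d` are the functions of
modulus `q` at `x` and `s₁, c₁, d₁` those of the complementary modulus `q'` at `y`. The denominator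
vanishes exactly at the poles of `sn`. -/
def jacobiSn (q : ℝ) (z : ℂ) : ℂ :=
  let s := realSn q z.re
  let c := realCn q z.re
  let d := realDn q z.re
  let s₁ := realSn (compModulus q) z.im
  let c₁ := realCn (compModulus q) z.im
  let d₁ := realDn (compModulus q) z.im
  ((s * d₁ : ℝ) + (c * d * s₁ * c₁ : ℝ) * Complex.I) / ((c₁ ^ 2 + q ^ 2 * s ^ 2 * s₁ ^ 2 : ℝ) : ℂ)

/-! ### Cell complexes made of unit squares of the square lattice

A complex is given by the set `P` of its elementary squares; the square with lower left corner
`(m, n)` is represented by `(m, n)`. -/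

/-- The four corners of the elementary square with lower left corner `s`. -/
def corners (s : ℤ × ℤ) : Set (ℤ × ℤ) :=
  {s, (s.1 + 1, s.2), (s.1 + 1, s.2 + 1), (s.1, s.2 + 1)}

/-- The vertices of the complex. -/
def vertices (P : Set (ℤ × ℤ)) : Set (ℤ × ℤ) := {v | ∃ s ∈ P, v ∈ corners s}

/-- The edges of the complex: the sides of its squares. -/
def edgeGraph (P : Set (ℤ × ℤ)) : SimpleGraph (ℤ × ℤ) where
  Adj x y := (∃ s ∈ P, x ∈ corners s ∧ y ∈ corners s) ∧ |x.1 - y.1| + |x.2 - y.2| = 1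
  symm := ⟨fun x y h => by
    obtain ⟨⟨s, hs, hx, hy⟩, h1⟩ := h
    exact ⟨⟨s, hs, hy, hx⟩, by rw [abs_sub_comm y.1, abs_sub_comm y.2]; exact h1⟩⟩
  loopless := ⟨fun x h => by simpa using h.2⟩

/-- Homotopy of edge paths in the complex (with fixed end points): the congruence generated by
deleting or inserting a back-and-forth step and by replacing two consecutive sides of a square of
the complex by the other two. -/
inductive PathHomotopic (P : Set (ℤ × ℤ)) :
    ∀ {u v : ℤ × ℤ}, (edgeGraph P).Walk u v → (edgeGraph P).Walk u v → Prop
  | refl {u v : ℤ × ℤ} (p : (edgeGraph P).Walk u v) : PathHomotopic P p p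
  | symm {u v : ℤ × ℤ} {p p' : (edgeGraph P).Walk u v} :
      PathHomotopic P p p' → PathHomotopic P p' p
  | trans {u v : ℤ × ℤ} {p p' p'' : (edgeGraph P).Walk u v} :
      PathHomotopic P p p' → PathHomotopic P p' p'' → PathHomotopic P p p''
  | cons {u v w : ℤ × ℤ} (h : (edgeGraph P).Adj u v) {p p' : (edgeGraph P).Walk v w} :
      PathHomotopic P p p' →
        PathHomotopic P (SimpleGraph.Walk.cons h p) (SimpleGraph.Walk.cons h p')
  | spur {u v w : ℤ × ℤ} (h : (edgeGraph P).Adj u v) (h' : (edgeGraph P).Adj v u)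
      (p : (edgeGraph P).Walk u w) :
      PathHomotopic P (SimpleGraph.Walk.cons h (SimpleGraph.Walk.cons h' p)) p
  | square {a b c d w : ℤ × ℤ} (s : ℤ × ℤ) (hs : s ∈ P) (ha : a ∈ corners s) (hb : b ∈ corners s)
      (hc : c ∈ corners s) (hd : d ∈ corners s)
      (hab : (edgeGraph P).Adj a b) (hbc : (edgeGraph P).Adj b c)
      (had : (edgeGraph P).Adj a d) (hdc : (edgeGraph P).Adj d c)
      (p : (edgeGraph P).Walk c w) :
      PathHomotopic P (SimpleGraph.Walk.cons hab (SimpleGraph.Walk.cons hbc p))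
        (SimpleGraph.Walk.cons had (SimpleGraph.Walk.cons hdc p))

/-- The complex is simply connected: it is non-empty and connected, and every closed edge path is
homotopic to the constant path (its edge path group is trivial). -/
def IsSimplyConnectedComplex (P : Set (ℤ × ℤ)) : Prop :=
  (vertices P).Nonempty ∧
  (∀ u ∈ vertices P, ∀ v ∈ vertices P, (edgeGraph P).Reachable u v) ∧
  ∀ u ∈ vertices P, ∀ p : (edgeGraph P).Walk u u, PathHomotopic P p SimpleGraph.Walk.nil

/-- The even vertices `G` of the complex; they carry the rings. -/
def evenVertices (P : Set (ℤ × ℤ)) : Set (ℤ × ℤ) := {v ∈ vertices P | Even (v.1 + v.2)}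

/-- The odd vertices `G*` of the complex; they carry the touching points. -/
def oddVertices (P : Set (ℤ × ℤ)) : Set (ℤ × ℤ) := {v ∈ vertices P | Odd (v.1 + v.2)}

/-- Two different even vertices are neighboring if they are opposite corners of a square of the
complex. -/
def Neighboring (P : Set (ℤ × ℤ)) (v w : ℤ × ℤ) : Prop :=
  v ≠ w ∧ Even (v.1 + v.2) ∧ Even (w.1 + w.2) ∧ ∃ s ∈ P, v ∈ corners s ∧ w ∈ corners s

/-- Any two even vertices are linked by a chain of neighboring even vertices. -/
def RingsConnected (P : Set (ℤ × ℤ)) : Prop :=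
  ∀ v ∈ evenVertices P, ∀ w ∈ evenVertices P, Relation.ReflTransGen (Neighboring P) v w

/-- All four squares around `v` belong to the complex. -/
def IsInternal (P : Set (ℤ × ℤ)) (v : ℤ × ℤ) : Prop :=
  v ∈ P ∧ (v.1 - 1, v.2) ∈ P ∧ (v.1, v.2 - 1) ∈ P ∧ (v.1 - 1, v.2 - 1) ∈ P

/-! ### Spherical rings -/

/-- The unit sphere `S²` in `ℝ³`. -/
def unitSphere : Set (Fin 3 → ℝ) := {x | x ⬝ᵥ x = 1}

/-- `n` is a unit tangent vector of `S²` at the point `p ∈ S²`. Then `(p, n, p × n)` is a positive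
orthonormal frame, and `p × n` is `n` turned counter-clockwise by a right angle. -/
def IsUnitTangent (p n : Fin 3 → ℝ) : Prop := p ∈ unitSphere ∧ n ⬝ᵥ n = 1 ∧ p ⬝ᵥ n = 0

/-- The oriented circle on `S²` with center `k` and signed spherical radius `ρ` passes through `p`
with oriented unit normal `n`: one reaches the center by going from `p` the signed distance `ρ`
along the geodesic in the direction `-n`. So `p` lies at spherical distance `|ρ|` from `k`
(for `|ρ| ≤ π`), and `p × n` is the direction of motion along the circle if it is run through
counter-clockwise (about `k`) for `ρ > 0` and clockwise for `ρ < 0`. -/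
def PassesThrough (k : Fin 3 → ℝ) (ρ : ℝ) (p n : Fin 3 → ℝ) : Prop :=
  k = Real.cos ρ • p - Real.sin ρ • n

/-- `r` and `R` are the signed inner radius and the outer radius of a spherical ring in a
half-sphere (first alternative), or of such a ring described from the antipode of its center, which
replaces `R` by `π - R` and `|r|` by `π - |r|` (second alternative). -/
def IsRing (r R : ℝ) : Prop :=
  (|r| < R ∧ R < Real.pi / 2) ∨ (Real.pi / 2 < R ∧ R < |r| ∧ |r| ≤ Real.pi)

/-- Generalized orthogonal ring pattern on the complex `P`. The ring at the even vertex `v` has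
center `k v`, inner circle of signed radius `r v` and (counter-clockwise) outer circle of radius
`R v`. At the odd vertex `w` there are a point `ℓ w` and a unit tangent vector `n w`, the
horizontal direction of the pattern. The inner circles of the rings to the left and to the right of
`w` pass through `ℓ w` with the opposite normals `± n w`, so they touch there; the outer circles of
the rings below and above `w` pass through `ℓ w` with the opposite normals `± ℓ w × n w`, so they
touch there and are orthogonal to the two inner circles. -/
structure IsGeneralizedRingPattern (P : Set (ℤ × ℤ)) (k : ℤ × ℤ → Fin 3 → ℝ) (r R : ℤ × ℤ → ℝ)
    (ℓ n : ℤ × ℤ → Fin 3 → ℝ) : Prop where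
  center : ∀ v ∈ evenVertices P, k v ∈ unitSphere
  frame : ∀ w ∈ oddVertices P, IsUnitTangent (ℓ w) (n w)
  left : ∀ w ∈ oddVertices P, ∀ v, v = (w.1 - 1, w.2) → (edgeGraph P).Adj w v →
    PassesThrough (k v) (r v) (ℓ w) (n w)
  right : ∀ w ∈ oddVertices P, ∀ v, v = (w.1 + 1, w.2) → (edgeGraph P).Adj w v →
    PassesThrough (k v) (r v) (ℓ w) (-n w)
  below : ∀ w ∈ oddVertices P, ∀ v, v = (w.1, w.2 - 1) → (edgeGraph P).Adj w v →
    PassesThrough (k v) (R v) (ℓ w) (ℓ w ⨯₃ n w)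
  above : ∀ w ∈ oddVertices P, ∀ v, v = (w.1, w.2 + 1) → (edgeGraph P).Adj w v →
    PassesThrough (k v) (R v) (ℓ w) (-(ℓ w ⨯₃ n w))

/-- Rings with the radii `r, R` build a generalized orthogonal ring pattern in the sphere. -/
def BuildGeneralizedRingPattern (P : Set (ℤ × ℤ)) (r R : ℤ × ℤ → ℝ) : Prop :=
  ∃ k ℓ n : ℤ × ℤ → Fin 3 → ℝ, IsGeneralizedRingPattern P k r R ℓ n

/-! ### The variables `β` -/

/-- The radii `r, R` of a ring with parameter `q` are given by the variable `β`. -/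
def Uniformizes (q β r R : ℝ) : Prop :=
  q * Real.cos r = Real.cos R ∧ Real.cos r = realSn q β ∧ Real.sin r = realCn q β ∧
    Real.sin R = realDn q β

/-- The equation at the even vertex `v`; the product is over its four neighbors
`(v.1 ± 1, v.2 ± 1)`. -/
def RingEquation (q : ℝ) (β : ℤ × ℤ → ℝ) (v : ℤ × ℤ) : Prop :=
  ∏ d ∈ ({1, -1} : Finset ℤ) ×ˢ ({1, -1} : Finset ℤ),
    jacobiSn q (((β v - β (v.1 + d.1, v.2 + d.2) : ℝ) + (ellipticK' q : ℂ) * Complex.I) / 2) /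
      jacobiSn q (((β v + β (v.1 + d.1, v.2 + d.2) : ℝ) + (ellipticK' q : ℂ) * Complex.I) / 2) = 1

end

open scoped Matrix

noncomputable section

/-! ### Elliptic integrals and the amplitude -/

/-! The pattern is encoded by frames in SO(3). A touching point with its horizontal normal is a
frame `F w`. Turning it by `j` right angles (`spin`) and moving along a geodesic by a radius
(`tilt`) gives a frame whose first vector is a ring center. A pattern therefore says exactly that
the frames arriving at an even vertex from its various directions share their first vector
(`buildGeneralizedRingPattern_iff`).

Consider two neighboring rings, their centers and their two common points. By orthogonality each
common point is the right angle of a spherical triangle with the two centers, whose legs are an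
inner radius of one ring and an outer radius of the other. Spherical Pythagoras at both points gives
cos r cos R' = cos R cos r'. Hence cos R / cos r is the same for neighbors, and by connectedness it
is one constant q (`exists_modulus`). Given this relation, the centers computed from the two points
agree if and only if the two frames at a center differ by a rotation through the sum of the two
triangle angles, `ringAngle` (`origin_eq_iff`).

At an internal vertex the four angles must close up to a multiple of 2π, so the product of four unit
complex numbers is 1. Conversely, if this holds at every internal vertex, the transports between
even and odd vertices can be chosen flat on each square, and simple connectivity integrates them to
a global choice of frames (`exists_section_of_steps`, `exists_isFramePattern`).

The elliptic input is that √q · sn is unimodular on the line Im z = K'/2, and that each quotient in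
the ring equation is minus the complex conjugate of the corresponding angle (`jacobiSn_quotient`).
The four signs cancel, so the ring equation is the closing condition (`ringEquation_iff`). The
addition theorems needed for this are derived from the differential equations of sn, cn, dn. -/

lemma one_sub_modulus_sq_pos {k : ℝ} (hk : 0 ≤ k) (hk' : k < 1) (t : ℝ) :
    0 < 1 - k ^ 2 * Real.sin t ^ 2 := by
  have h1 : k ^ 2 < 1 := by nlinarith
  nlinarith [Real.sin_sq_le_one t, sq_nonneg (Real.sin t), sq_nonneg k]

lemma continuous_ellipticF_integrand {k : ℝ} (hk : 0 ≤ k) (hk' : k < 1) :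
    Continuous fun t : ℝ => 1 / Real.sqrt (1 - k ^ 2 * Real.sin t ^ 2) := by
  refine Continuous.div continuous_const (by fun_prop) fun t => ?_
  exact (Real.sqrt_pos.2 (one_sub_modulus_sq_pos hk hk' t)).ne'

lemma hasDerivAt_ellipticF {k : ℝ} (hk : 0 ≤ k) (hk' : k < 1) (φ : ℝ) :
    HasDerivAt (ellipticF k) (1 / Real.sqrt (1 - k ^ 2 * Real.sin φ ^ 2)) φ :=
  (continuous_ellipticF_integrand hk hk').integral_hasStrictDerivAt 0 φ |>.hasDerivAt

lemma one_le_ellipticF_integrand {k : ℝ} (hk : 0 ≤ k) (hk' : k < 1) (t : ℝ) :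
    1 ≤ 1 / Real.sqrt (1 - k ^ 2 * Real.sin t ^ 2) := by
  have h := Real.sqrt_pos.2 (one_sub_modulus_sq_pos hk hk' t)
  rw [le_div_iff₀ h, one_mul]
  refine Real.sqrt_le_one.2 ?_
  nlinarith [mul_nonneg (sq_nonneg k) (sq_nonneg (Real.sin t))]

/-- The integrand is at least 1, so F grows at least as fast as the identity. Strict monotonicity
and surjectivity of F both follow from this. -/
lemma monotone_ellipticF_sub {k : ℝ} (hk : 0 ≤ k) (hk' : k < 1) :
    Monotone fun φ => ellipticF k φ - φ := by
  have hd : ∀ x, HasDerivAt (fun φ => ellipticF k φ - φ)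
      (1 / Real.sqrt (1 - k ^ 2 * Real.sin x ^ 2) - 1) x := fun x =>
    (hasDerivAt_ellipticF hk hk' x).sub (hasDerivAt_id x)
  refine monotone_of_deriv_nonneg (fun x => (hd x).differentiableAt) fun x => ?_
  rw [(hd x).deriv]
  linarith [one_le_ellipticF_integrand hk hk' x]

lemma strictMono_ellipticF {k : ℝ} (hk : 0 ≤ k) (hk' : k < 1) : StrictMono (ellipticF k) := by
  intro a b hab
  have := monotone_ellipticF_sub hk hk' hab.le
  simp only at this
  linarith

@[simp] lemma ellipticF_zero (k : ℝ) : ellipticF k 0 = 0 := by simp [ellipticF]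

lemma ellipticF_neg (k φ : ℝ) : ellipticF k (-φ) = -ellipticF k φ := by
  unfold ellipticF
  have h := intervalIntegral.integral_comp_neg (a := 0) (b := φ)
    (fun t : ℝ => 1 / Real.sqrt (1 - k ^ 2 * Real.sin t ^ 2))
  simp only [Real.sin_neg, neg_sq, neg_zero] at h
  rw [h, intervalIntegral.integral_symm]

lemma continuous_ellipticF {k : ℝ} (hk : 0 ≤ k) (hk' : k < 1) : Continuous (ellipticF k) :=
  continuous_iff_continuousAt.2 fun x => (hasDerivAt_ellipticF hk hk' x).continuousAt

lemma surjective_ellipticF {k : ℝ} (hk : 0 ≤ k) (hk' : k < 1) :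
    Function.Surjective (ellipticF k) := by
  refine (continuous_ellipticF hk hk').surjective ?_ ?_
  · refine Filter.tendsto_atTop_mono' _ ?_ Filter.tendsto_id
    filter_upwards [Filter.eventually_ge_atTop 0] with x hx
    have := monotone_ellipticF_sub hk hk' hx
    simp at this
    simpa using this
  · refine Filter.tendsto_atBot_mono' _ ?_ Filter.tendsto_id
    filter_upwards [Filter.eventually_le_atBot 0] with x hx
    have := monotone_ellipticF_sub hk hk' hx
    simp at this
    simpa using this

/-- The integrand is even and π-periodic, so [0, 2π] splits into four quarters of equal integral. It
turns the range [0, 2π] of the amplitude into the range [0, 4K] of β. -/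
lemma ellipticF_two_pi {k : ℝ} (hk : 0 ≤ k) (hk' : k < 1) :
    ellipticF k (2 * Real.pi) = 4 * ellipticK k := by
  have hc := continuous_ellipticF_integrand hk hk'
  have hi : ∀ a b, IntervalIntegrable (fun t : ℝ => 1 / Real.sqrt (1 - k ^ 2 * Real.sin t ^ 2))
      MeasureTheory.volume a b := fun a b => hc.intervalIntegrable a b
  have hper : Function.Periodic
      (fun t : ℝ => 1 / Real.sqrt (1 - k ^ 2 * Real.sin t ^ 2)) Real.pi := fun t => by
    simp [Real.sin_add_pi]
  have h1 : ellipticF k Real.pi = 2 * ellipticK k := by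
    have h := hper.intervalIntegral_add_eq (-(Real.pi / 2)) 0
    rw [show -(Real.pi / 2) + Real.pi = Real.pi / 2 by ring, zero_add,
      ← intervalIntegral.integral_add_adjacent_intervals (hi _ 0) (hi 0 _),
      intervalIntegral.integral_symm] at h
    have h2 := ellipticF_neg k (Real.pi / 2)
    unfold ellipticK
    unfold ellipticF at h2 ⊢
    linarith
  have h := hper.intervalIntegral_add_eq Real.pi 0
  rw [zero_add, show Real.pi + Real.pi = 2 * Real.pi by ring] at h
  have h3 := intervalIntegral.integral_add_adjacent_intervals (hi 0 Real.pi)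
    (hi Real.pi (2 * Real.pi))
  unfold ellipticF at h1 ⊢
  linarith

lemma jacobiAm_ellipticF {k : ℝ} (hk : 0 ≤ k) (hk' : k < 1) (φ : ℝ) :
    jacobiAm k (ellipticF k φ) = φ := by
  rw [jacobiAm, if_neg hk'.ne]
  exact Function.leftInverse_invFun (strictMono_ellipticF hk hk').injective φ

lemma ellipticF_jacobiAm {k : ℝ} (hk : 0 ≤ k) (hk' : k < 1) (u : ℝ) :
    ellipticF k (jacobiAm k u) = u := by
  rw [jacobiAm, if_neg hk'.ne]
  exact Function.rightInverse_invFun (surjective_ellipticF hk hk') u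

/-! ### The differential equations -/

/-- The differential equations, initial values, parities and quadratic relations of the Jacobi
functions `sn`, `cn`, `dn` of modulus `k`. -/
structure IsJacobiTriple (k : ℝ) (s c d : ℝ → ℝ) : Prop where
  hasDerivAt_s : ∀ x, HasDerivAt s (c x * d x) x
  hasDerivAt_c : ∀ x, HasDerivAt c (-(s x * d x)) x
  hasDerivAt_d : ∀ x, HasDerivAt d (-(k ^ 2 * s x * c x)) x
  s_zero : s 0 = 0
  c_zero : c 0 = 1
  d_zero : d 0 = 1
  s_neg : ∀ x, s (-x) = -s x
  c_neg : ∀ x, c (-x) = c x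
  d_neg : ∀ x, d (-x) = d x
  c_sq : ∀ x, c x ^ 2 = 1 - s x ^ 2
  d_sq : ∀ x, d x ^ 2 = 1 - k ^ 2 * s x ^ 2
  d_pos : ∀ x, 0 < d x

/-- Everything follows from am' = √(1 - k² sin² am) and the oddness of am. This treats the inverse
integral (k < 1) and the Gudermannian (k = 1) together. -/
lemma isJacobiTriple_of_amplitude {k : ℝ}
    (hpos : ∀ u, 0 < 1 - k ^ 2 * Real.sin (jacobiAm k u) ^ 2)
    (hd : ∀ u, HasDerivAt (jacobiAm k) (Real.sqrt (1 - k ^ 2 * Real.sin (jacobiAm k u) ^ 2)) u)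
    (h0 : jacobiAm k 0 = 0) (hneg : ∀ u, jacobiAm k (-u) = -jacobiAm k u) :
    IsJacobiTriple k (realSn k) (realCn k) (realDn k) where
  hasDerivAt_s x := (hd x).sin
  hasDerivAt_c x := by
    have := (hd x).cos
    rwa [neg_mul] at this
  hasDerivAt_d x := by
    have h := (((((hd x).sin).pow 2).const_mul (k ^ 2)).const_sub 1).sqrt (hpos x).ne'
    have hs := (Real.sqrt_pos.2 (hpos x)).ne'
    refine h.congr_deriv ?_
    simp only [Pi.pow_apply]
    rw [div_eq_iff (mul_ne_zero two_ne_zero hs)]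
    simp only [realSn, realCn]
    push_cast
    ring
  s_zero := by simp [realSn, h0]
  c_zero := by simp [realCn, h0]
  d_zero := by simp [realDn, realSn, h0]
  s_neg x := by simp [realSn, hneg]
  c_neg x := by simp [realCn, hneg]
  d_neg x := by simp [realDn, realSn, hneg]
  c_sq x := by simp [realSn, realCn, Real.cos_sq']
  d_sq x := Real.sq_sqrt (hpos x).le
  d_pos x := Real.sqrt_pos.2 (hpos x)

lemma isJacobiTriple_of_lt_one {k : ℝ} (hk : 0 ≤ k) (hk' : k < 1) :
    IsJacobiTriple k (realSn k) (realCn k) (realDn k) := by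
  have hinj := (strictMono_ellipticF hk hk').injective
  refine isJacobiTriple_of_amplitude (fun u => one_sub_modulus_sq_pos hk hk' _) (fun u => ?_)
    ?_ fun u => ?_
  · have hcont : Continuous (jacobiAm k) := by
      have : jacobiAm k = ((strictMono_ellipticF hk hk').orderIsoOfSurjective _
        (surjective_ellipticF hk hk')).symm := by
        funext u
        rw [OrderIso.eq_symm_apply]
        exact ellipticF_jacobiAm hk hk' u
      rw [this]
      exact OrderIso.continuous _
    have h := HasDerivAt.of_local_left_inverse hcont.continuousAt
      (hasDerivAt_ellipticF hk hk' (jacobiAm k u))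
      (by have := Real.sqrt_pos.2 (one_sub_modulus_sq_pos hk hk' (jacobiAm k u)); positivity)
      (Filter.Eventually.of_forall fun v => ellipticF_jacobiAm hk hk' v)
    simpa using h
  · simpa using jacobiAm_ellipticF hk hk' 0
  · apply hinj
    rw [ellipticF_neg, ellipticF_jacobiAm hk hk', ellipticF_jacobiAm hk hk']

lemma one_sub_tanh_sq (u : ℝ) : 1 - Real.tanh u ^ 2 = (1 / Real.cosh u) ^ 2 := by
  have h := (Real.cosh_pos u).ne'
  rw [Real.tanh_eq_sinh_div_cosh]
  field_simp
  linarith [Real.cosh_sq u]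

lemma isJacobiTriple_one : IsJacobiTriple 1 (realSn 1) (realCn 1) (realDn 1) := by
  have hlt : ∀ u, |Real.tanh u| < 1 := fun u => by
    rw [← sq_lt_one_iff_abs_lt_one]
    have := one_sub_tanh_sq u
    have h2 : 0 < (1 / Real.cosh u) ^ 2 := by have := Real.cosh_pos u; positivity
    linarith
  have ham : ∀ u, jacobiAm 1 u = Real.arcsin (Real.tanh u) := fun u => if_pos rfl
  have hsin : ∀ u, Real.sin (jacobiAm 1 u) = Real.tanh u := fun u => by
    rw [ham, Real.sin_arcsin] <;> linarith [abs_lt.1 (hlt u)]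
  have hsq : ∀ u, Real.sqrt (1 - Real.tanh u ^ 2) = 1 / Real.cosh u := fun u => by
    rw [one_sub_tanh_sq, Real.sqrt_sq]
    have := Real.cosh_pos u
    positivity
  refine isJacobiTriple_of_amplitude (fun u => ?_) (fun u => ?_) ?_ fun u => ?_
  · rw [hsin, one_pow, one_mul, one_sub_tanh_sq]
    have := Real.cosh_pos u
    positivity
  · rw [hsin, one_pow, one_mul, hsq]
    have hc := (Real.cosh_pos u).ne'
    have h1 : HasDerivAt Real.tanh ((1 / Real.cosh u) ^ 2) u := by
      have h := (Real.hasDerivAt_sinh u).div (Real.hasDerivAt_cosh u) hc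
      have he : Real.tanh = Real.sinh / Real.cosh := by
        funext x
        exact Real.tanh_eq_sinh_div_cosh x
      rw [he]
      refine h.congr_deriv ?_
      field_simp
      linarith [Real.cosh_sq u]
    have h2 := (Real.hasDerivAt_arcsin (x := Real.tanh u) (by linarith [abs_lt.1 (hlt u)])
      (by linarith [abs_lt.1 (hlt u)])).comp u h1
    have he : jacobiAm 1 = Real.arcsin ∘ Real.tanh := funext ham
    rw [he]
    refine h2.congr_deriv ?_
    rw [hsq]
    field_simp
  · simp [ham]
  · simp [ham, Real.tanh_neg, Real.arcsin_neg]

lemma isJacobiTriple {k : ℝ} (hk : 0 ≤ k) (hk' : k ≤ 1) :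
    IsJacobiTriple k (realSn k) (realCn k) (realDn k) := by
  rcases hk'.lt_or_eq with h | rfl
  · exact isJacobiTriple_of_lt_one hk h
  · exact isJacobiTriple_one

/-! ### Addition theorems -/

namespace IsJacobiTriple

variable {k : ℝ} {s c d : ℝ → ℝ}

/-- The expression equals d(x)² + k² s(x)² c(y)², and d(x) > 0. The bound thus survives at k = 1. -/
lemma denom_pos (h : IsJacobiTriple k s c d) (x y : ℝ) : 0 < 1 - k ^ 2 * s x ^ 2 * s y ^ 2 := by
  have h1 := h.d_sq x
  have h2 := h.c_sq y
  have h3 := pow_pos (h.d_pos x) 2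
  nlinarith [sq_nonneg (c y), mul_nonneg (sq_nonneg (k * s x)) (sq_nonneg (c y))]

lemma modulus_sq_pos (h : IsJacobiTriple k s c d) (x y : ℝ) :
    0 < 1 - (k * s x * s y) ^ 2 := by
  have := h.denom_pos x y
  nlinarith

lemma hasDerivAt_comp_sub {f : ℝ → ℝ} {f' : ℝ} {t x : ℝ} (hf : HasDerivAt f f' (t - x)) :
    HasDerivAt (fun x => f (t - x)) (-f') x := by
  have := hf.comp x ((hasDerivAt_id x).const_sub t)
  simpa [Function.comp_def] using this

/-- Euler's method: along x + y = t the right-hand side of an addition theorem has derivative zero,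
hence equals its value at x = 0, where the denominator is 1. The second hypothesis is the vanishing
of the numerator in the quotient rule. -/
lemma eq_of_quotient_deriv (h : IsJacobiTriple k s c d) {N N' : ℝ → ℝ} (t : ℝ)
    (hN : ∀ x, HasDerivAt N (N' x) x)
    (hN' : ∀ x, N' x * (1 - k ^ 2 * s x ^ 2 * s (t - x) ^ 2) = N x *
      (-(2 * k ^ 2 * s x * s (t - x) * (c x * d x * s (t - x) - s x * c (t - x) * d (t - x)))))
    (x : ℝ) : N x / (1 - k ^ 2 * s x ^ 2 * s (t - x) ^ 2) = N 0 := by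
  have hd : ∀ x, HasDerivAt (fun x => N x / (1 - k ^ 2 * s x ^ 2 * s (t - x) ^ 2)) 0 x := by
    intro x
    have e1 := h.hasDerivAt_s x
    have e2 : HasDerivAt (fun x => s (t - x)) (-(c (t - x) * d (t - x))) x :=
      hasDerivAt_comp_sub (h.hasDerivAt_s _)
    have e3 := (hN x).div ((((e1.pow 2).const_mul (k ^ 2)).mul (e2.pow 2)).const_sub 1)
      (h.denom_pos x (t - x)).ne'
    refine e3.congr_deriv ?_
    rw [div_eq_zero_iff]
    left
    simp only [Pi.pow_apply, Pi.mul_apply]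
    rw [hN' x]
    push_cast
    ring
  have := is_const_of_deriv_eq_zero (fun x => (hd x).differentiableAt) (fun x => (hd x).deriv) x 0
  simpa [h.s_zero] using this

lemma s_add (h : IsJacobiTriple k s c d) (x y : ℝ) :
    s (x + y) = (s x * c y * d y + s y * c x * d x) / (1 - k ^ 2 * s x ^ 2 * s y ^ 2) := by
  have key := h.eq_of_quotient_deriv (x + y)
    (N := fun z => s z * c (x + y - z) * d (x + y - z) + s (x + y - z) * c z * d z)
    (fun z => (((h.hasDerivAt_s z).mul (hasDerivAt_comp_sub (h.hasDerivAt_c _))).mul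
      (hasDerivAt_comp_sub (h.hasDerivAt_d _))).add
      (((hasDerivAt_comp_sub (h.hasDerivAt_s _)).mul (h.hasDerivAt_c z)).mul (h.hasDerivAt_d z)))
    (fun z => by
      have a1 := h.c_sq z
      have a2 := h.d_sq z
      have a3 := h.c_sq (x + y - z)
      have a4 := h.d_sq (x + y - z)
      simp only [Pi.mul_apply]
      generalize s z = S at *
      generalize c z = C at *
      generalize d z = D at *
      generalize s (x + y - z) = S' at *
      generalize c (x + y - z) = C' at *
      generalize d (x + y - z) = D' at *
      grind) x
  simp only [add_sub_cancel_left, sub_zero, h.s_zero, h.c_zero, h.d_zero] at key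
  rw [key]
  ring

lemma c_add (h : IsJacobiTriple k s c d) (x y : ℝ) :
    c (x + y) = (c x * c y - s x * s y * d x * d y) / (1 - k ^ 2 * s x ^ 2 * s y ^ 2) := by
  have key := h.eq_of_quotient_deriv (x + y)
    (N := fun z => c z * c (x + y - z) - s z * s (x + y - z) * d z * d (x + y - z))
    (fun z => ((h.hasDerivAt_c z).mul (hasDerivAt_comp_sub (h.hasDerivAt_c _))).sub
      ((((h.hasDerivAt_s z).mul (hasDerivAt_comp_sub (h.hasDerivAt_s _))).mul
        (h.hasDerivAt_d z)).mul (hasDerivAt_comp_sub (h.hasDerivAt_d _))))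
    (fun z => by
      have a1 := h.c_sq z
      have a2 := h.d_sq z
      have a3 := h.c_sq (x + y - z)
      have a4 := h.d_sq (x + y - z)
      simp only [Pi.mul_apply]
      generalize s z = S at *
      generalize c z = C at *
      generalize d z = D at *
      generalize s (x + y - z) = S' at *
      generalize c (x + y - z) = C' at *
      generalize d (x + y - z) = D' at *
      grind) x
  simp only [add_sub_cancel_left, sub_zero, h.s_zero, h.c_zero, h.d_zero] at key
  rw [key]
  ring

lemma d_add (h : IsJacobiTriple k s c d) (x y : ℝ) :
    d (x + y) = (d x * d y - k ^ 2 * s x * s y * c x * c y) /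
      (1 - k ^ 2 * s x ^ 2 * s y ^ 2) := by
  have key := h.eq_of_quotient_deriv (x + y)
    (N := fun z => d z * d (x + y - z) - k ^ 2 * s z * s (x + y - z) * c z * c (x + y - z))
    (fun z => ((h.hasDerivAt_d z).mul (hasDerivAt_comp_sub (h.hasDerivAt_d _))).sub
      (((((h.hasDerivAt_s z).const_mul (k ^ 2)).mul (hasDerivAt_comp_sub (h.hasDerivAt_s _))).mul
        (h.hasDerivAt_c z)).mul (hasDerivAt_comp_sub (h.hasDerivAt_c _))))
    (fun z => by
      have a1 := h.c_sq z
      have a2 := h.d_sq z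
      have a3 := h.c_sq (x + y - z)
      have a4 := h.d_sq (x + y - z)
      simp only [Pi.mul_apply]
      generalize s z = S at *
      generalize c z = C at *
      generalize d z = D at *
      generalize s (x + y - z) = S' at *
      generalize c (x + y - z) = C' at *
      generalize d (x + y - z) = D' at *
      grind) x
  simp only [add_sub_cancel_left, sub_zero, h.s_zero, h.c_zero, h.d_zero] at key
  rw [key]
  ring

end IsJacobiTriple

/-! ### The half period and `sn` on the line `Im z = K' / 2` -/

/-- Doubling K/2: cn K = 0 gives c² = s²d², and dn K = κ then gives d² = κ. The rest follows from c²
= 1 - s². -/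
lemma half_period_values {k κ : ℝ} (hk : 0 ≤ k) (hκ : 0 < κ) (h : k ^ 2 = 1 - κ ^ 2) :
    0 < realSn k (ellipticK k / 2) ∧ 0 < realCn k (ellipticK k / 2) ∧
    realSn k (ellipticK k / 2) ^ 2 = 1 / (1 + κ) ∧ realCn k (ellipticK k / 2) ^ 2 = κ / (1 + κ) ∧
    realDn k (ellipticK k / 2) ^ 2 = κ := by
  have hk' : k < 1 := by nlinarith
  have J := isJacobiTriple hk hk'.le
  have hmono := strictMono_ellipticF hk hk'
  have hK : 0 < ellipticK k := by
    have := hmono (show (0 : ℝ) < Real.pi / 2 by positivity)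
    rwa [ellipticF_zero] at this
  have hpos : 0 < jacobiAm k (ellipticK k / 2) := by
    rw [← hmono.lt_iff_lt, ellipticF_jacobiAm hk hk', ellipticF_zero]
    linarith
  have hlt : jacobiAm k (ellipticK k / 2) < Real.pi / 2 := by
    rw [← hmono.lt_iff_lt, ellipticF_jacobiAm hk hk']
    change _ < ellipticK k
    linarith
  have hs : 0 < realSn k (ellipticK k / 2) :=
    Real.sin_pos_of_pos_of_lt_pi hpos (by linarith)
  have hc : 0 < realCn k (ellipticK k / 2) :=
    Real.cos_pos_of_mem_Ioo ⟨by linarith, hlt⟩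
  have hamK : jacobiAm k (ellipticK k) = Real.pi / 2 := jacobiAm_ellipticF hk hk' _
  have hsK : realSn k (ellipticK k) = 1 := by simp [realSn, hamK]
  have hcK : realCn k (ellipticK k) = 0 := by simp [realCn, hamK]
  have hdK : realDn k (ellipticK k) = κ := by
    rw [realDn, hsK, show 1 - k ^ 2 * 1 ^ 2 = κ ^ 2 by linarith, Real.sqrt_sq hκ.le]
  have h1 := J.c_add (ellipticK k / 2) (ellipticK k / 2)
  have h2 := J.d_add (ellipticK k / 2) (ellipticK k / 2)
  have hD := (J.denom_pos (ellipticK k / 2) (ellipticK k / 2)).ne'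
  rw [add_halves, hcK, eq_div_iff hD] at h1
  rw [add_halves, hdK, eq_div_iff hD] at h2
  have hc2 := J.c_sq (ellipticK k / 2)
  have hd2 := J.d_sq (ellipticK k / 2)
  generalize realSn k (ellipticK k / 2) = s at *
  generalize realCn k (ellipticK k / 2) = c at *
  generalize realDn k (ellipticK k / 2) = d at *
  have hd3 : d ^ 2 = κ := by
    have : (d ^ 2 - κ) * (1 - k ^ 2 * s ^ 2 * s ^ 2) = 0 := by
      have e : c ^ 2 = s ^ 2 * d ^ 2 := by linarith
      linear_combination (k ^ 2 * s ^ 2) * e - h2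
    rcases mul_eq_zero.1 this with h | h
    · linarith
    · exact absurd h hD
  have hs3 : s ^ 2 * (1 + κ) = 1 := by
    have e : c ^ 2 = s ^ 2 * d ^ 2 := by linarith
    rw [hd3] at e
    linarith
  refine ⟨hs, hc, ?_, ?_, hd3⟩
  · rw [eq_div_iff (by positivity)]; exact hs3
  · rw [eq_div_iff (by positivity), hc2]; linarith

/-- The imaginary part sits at half the quarter period of the complementary modulus, where the
values come from `half_period_values` with κ = q. The second factor on the right has modulus 1. -/
lemma jacobiSn_half_period {q : ℝ} (hq : 0 < q) (hq' : q ≤ 1) {z : ℂ}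
    (hz : z.im = ellipticK' q / 2) :
    jacobiSn q z = (((Real.sqrt q)⁻¹ : ℝ) : ℂ) *
      ((((1 + q) * realSn q z.re : ℝ) + (realCn q z.re * realDn q z.re : ℝ) * Complex.I) /
        ((1 + q * realSn q z.re ^ 2 : ℝ) : ℂ)) := by
  have hq2 : compModulus q ^ 2 = 1 - q ^ 2 := Real.sq_sqrt (by nlinarith)
  obtain ⟨h1, h2, h3, h4, h5⟩ :=
    half_period_values (k := compModulus q) (Real.sqrt_nonneg _) hq hq2
  have hd : 0 < realDn (compModulus q) (ellipticK (compModulus q) / 2) :=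
    (isJacobiTriple (k := compModulus q) (Real.sqrt_nonneg _) (by nlinarith)).d_pos _
  unfold jacobiSn
  simp only [hz, ellipticK']
  generalize realSn (compModulus q) (ellipticK (compModulus q) / 2) = s₁ at *
  generalize realCn (compModulus q) (ellipticK (compModulus q) / 2) = c₁ at *
  generalize realDn (compModulus q) (ellipticK (compModulus q) / 2) = d₁ at *
  generalize realSn q z.re = s at *
  generalize realCn q z.re * realDn q z.re = e at *
  have hd1 : d₁ = Real.sqrt q := by
    rw [← h5, Real.sqrt_sq hd.le]
  have hsc : s₁ * c₁ = Real.sqrt q / (1 + q) := by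
    have : (s₁ * c₁) ^ 2 = (Real.sqrt q / (1 + q)) ^ 2 := by
      rw [mul_pow, h3, h4, div_pow, Real.sq_sqrt hq.le]
      field_simp
    exact (pow_left_inj₀ (by positivity) (by positivity) two_ne_zero).1 this
  have hden : c₁ ^ 2 + q ^ 2 * s ^ 2 * s₁ ^ 2 = q / (1 + q) * (1 + q * s ^ 2) := by
    rw [h3, h4]
    field_simp
  rw [hden, hd1, mul_assoc e, hsc]
  have hx : Real.sqrt q ^ 2 = q := Real.sq_sqrt hq.le
  have hx0 : 0 < Real.sqrt q := Real.sqrt_pos.2 hq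
  generalize Real.sqrt q = x at *
  subst hx
  have hx1 : (1 + (x : ℂ) ^ 2) ≠ 0 := by exact_mod_cast (by positivity : (1 + x ^ 2 : ℝ) ≠ 0)
  have hx2 : (1 + (x : ℂ) ^ 2 * s ^ 2) ≠ 0 := by
    exact_mod_cast (by positivity : (1 + x ^ 2 * s ^ 2 : ℝ) ≠ 0)
  have hx3 : (x : ℂ) ≠ 0 := by exact_mod_cast hx0.ne'
  push_cast
  field_simp

namespace IsJacobiTriple

variable {k : ℝ} {s c d : ℝ → ℝ}

/-- With x = b + a and y = b - a, these rewrite the real and imaginary parts of a ring angle through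
functions at a and b, the real parts of the arguments in the ring equation. -/
lemma product_formulas (h : IsJacobiTriple k s c d) (a b : ℝ) :
    c (b + a) * s (b - a) = (s b * c b * d a - s a * c a * d b) /
      (1 - k ^ 2 * s b ^ 2 * s a ^ 2) ∧
    d (b + a) * s (b - a) = (s b * d b * c a - s a * d a * c b) /
      (1 - k ^ 2 * s b ^ 2 * s a ^ 2) ∧
    c (b + a) * c (b - a) = (1 - s a ^ 2 - s b ^ 2 + k ^ 2 * s a ^ 2 * s b ^ 2) /
      (1 - k ^ 2 * s b ^ 2 * s a ^ 2) ∧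
    d (b + a) * d (b - a) = (1 - k ^ 2 * s a ^ 2 - k ^ 2 * s b ^ 2 + k ^ 2 * s a ^ 2 * s b ^ 2) /
      (1 - k ^ 2 * s b ^ 2 * s a ^ 2) ∧
    c (b - a) * d (b - a) = (c a * d a * c b * d b * (1 + k ^ 2 * s a ^ 2 * s b ^ 2) +
      s a * s b * (d a ^ 2 * d b ^ 2 + k ^ 2 * c a ^ 2 * c b ^ 2)) /
      (1 - k ^ 2 * s b ^ 2 * s a ^ 2) ^ 2 ∧
    1 - k ^ 2 * s (b + a) ^ 2 * s (b - a) ^ 2 =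
      (1 - k ^ 2 * s a ^ 4) * (1 - k ^ 2 * s b ^ 4) / (1 - k ^ 2 * s b ^ 2 * s a ^ 2) ^ 2 := by
  have hs1 := h.s_add b a
  have hc1 := h.c_add b a
  have hd1 := h.d_add b a
  have hs2 := h.s_add b (-a)
  have hc2 := h.c_add b (-a)
  have hd2 := h.d_add b (-a)
  simp only [← sub_eq_add_neg, h.s_neg, h.c_neg, h.d_neg, neg_sq] at hs2 hc2 hd2
  have hD := (h.denom_pos b a).ne'
  have a1 := h.c_sq a
  have a2 := h.d_sq a
  have a3 := h.c_sq b
  have a4 := h.d_sq b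
  rw [hs1, hc1, hd1, hs2, hc2, hd2]
  generalize s a = sa at *
  generalize c a = ca at *
  generalize d a = da at *
  generalize s b = sb at *
  generalize c b = cb at *
  generalize d b = db at *
  generalize hΔ : 1 - k ^ 2 * sb ^ 2 * sa ^ 2 = Δ at *
  refine ⟨?_, ?_, ?_, ?_, ?_, ?_⟩
  all_goals field_simp
  all_goals subst hΔ
  · grind
  · grind
  · grind
  · grind
  · grind
  · grind

end IsJacobiTriple

lemma jacobiSn_quotient {q : ℝ} (hq : 0 < q) (hq' : q ≤ 1) (x y : ℝ) :
    jacobiSn q (((x - y : ℝ) + (ellipticK' q : ℂ) * Complex.I) / 2) /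
        jacobiSn q (((x + y : ℝ) + (ellipticK' q : ℂ) * Complex.I) / 2) =
      -(starRingEnd ℂ)
        (((realCn q x * (q * realSn q y) : ℝ) + (realDn q y : ℝ) * Complex.I) *
          ((realDn q x * realSn q y : ℝ) + (realCn q y : ℝ) * Complex.I) /
          ((1 - (q * realSn q x * realSn q y) ^ 2 : ℝ) : ℂ)) := by
  have J := isJacobiTriple hq.le hq'
  have him : ∀ t : ℝ, (((t : ℝ) + (ellipticK' q : ℂ) * Complex.I) / 2).im = ellipticK' q / 2 := by
    intro t
    simp
  have hre : ∀ t : ℝ, (((t : ℝ) + (ellipticK' q : ℂ) * Complex.I) / 2).re = t / 2 := by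
    intro t
    simp
  rw [jacobiSn_half_period hq hq' (him _), jacobiSn_half_period hq hq' (him _), hre, hre]
  obtain ⟨a, ha⟩ : ∃ a, a = (x - y) / 2 := ⟨_, rfl⟩
  obtain ⟨b, hb⟩ : ∃ b, b = (x + y) / 2 := ⟨_, rfl⟩
  have hx : x = b + a := by rw [ha, hb]; ring
  have hy : y = b - a := by rw [ha, hb]; ring
  rw [← ha, ← hb]
  subst hx hy
  clear ha hb
  have hD := J.modulus_sq_pos (b + a) (b - a)
  have hΔ := J.denom_pos b a
  obtain ⟨p1, p2, p3, p4, p5, p6⟩ := J.product_formulas a b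
  have hs := J.s_add b (-a)
  simp only [← sub_eq_add_neg, J.s_neg, J.c_neg, J.d_neg, neg_sq] at hs
  have a1 := J.c_sq a
  have a2 := J.d_sq a
  have a3 := J.c_sq b
  have a4 := J.d_sq b
  have hx0 : Real.sqrt q ≠ 0 := (Real.sqrt_pos.2 hq).ne'
  have p6' : 1 - (q * realSn q (b + a) * realSn q (b - a)) ^ 2 = _ :=
    (by ring : _ = 1 - q ^ 2 * realSn q (b + a) ^ 2 * realSn q (b - a) ^ 2).trans p6
  generalize realSn q (b + a) = S at *
  generalize realCn q (b + a) = C at *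
  generalize realDn q (b + a) = D at *
  generalize realSn q (b - a) = S' at *
  generalize realCn q (b - a) = C' at *
  generalize realDn q (b - a) = D' at *
  generalize realSn q a = sa at *
  generalize realCn q a = ca at *
  generalize realDn q a = da at *
  generalize realSn q b = sb at *
  generalize realCn q b = cb at *
  generalize realDn q b = db at *
  generalize hΔe : 1 - q ^ 2 * sb ^ 2 * sa ^ 2 = Δ at *
  have hDne := hD.ne'
  have hA : 0 < 1 + q * sa ^ 2 := by positivity
  have hB : 0 < 1 + q * sb ^ 2 := by positivity
  -- Each factor 1 - q²s⁴ splits as (1 - qs²)(1 + qs²); the factors 1 + qs² are the denominators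
  -- from `jacobiSn_half_period`.
  have e6 : (1 - (q * S * S') ^ 2) * Δ ^ 2 = (1 - q ^ 2 * sa ^ 4) * (1 - q ^ 2 * sb ^ 4) := by
    rw [p6']
    field_simp
  generalize 1 - (q * S * S') ^ 2 = E at *
  have re_eq : (q * (C * S') * (D * S') - C' * D') * ((1 + q * sa ^ 2) * (1 + q * sb ^ 2)) =
      -((1 + q) ^ 2 * sa * sb + ca * da * cb * db) * E := by
    have h1 : (q * (C * S') * (D * S') - C' * D') * Δ ^ 2 =
        -((1 + q) ^ 2 * sa * sb + ca * da * cb * db) *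
          ((1 - q * sa ^ 2) * (1 - q * sb ^ 2)) := by
      rw [p1, p2, p5]
      field_simp
      clear p1 p2 p3 p4 p5 p6 p6' hs e6 hΔ J him hre hx0 hΔe
      grind
    apply mul_right_cancel₀ (pow_pos hΔ 2).ne'
    linear_combination ((1 + q * sa ^ 2) * (1 + q * sb ^ 2)) * h1 +
      ((1 + q) ^ 2 * sa * sb + ca * da * cb * db) * e6
  have im_eq : S' * (q * (C * C') + D * D') * ((1 + q * sa ^ 2) * (1 + q * sb ^ 2)) =
      (1 + q) * (sb * ca * da - sa * cb * db) * E := by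
    have h1 : S' * (q * (C * C') + D * D') * Δ ^ 2 =
        (1 + q) * (sb * ca * da - sa * cb * db) * ((1 - q * sa ^ 2) * (1 - q * sb ^ 2)) := by
      rw [p3, p4, hs]
      field_simp
      grind
    apply mul_right_cancel₀ (pow_pos hΔ 2).ne'
    linear_combination ((1 + q * sa ^ 2) * (1 + q * sb ^ 2)) * h1 -
      (1 + q) * (sb * ca * da - sa * cb * db) * e6
  -- Unimodularity of √q · sn on the line: division by the value at b becomes multiplication by its
  -- conjugate.
  have unit : ((1 + q) * sb) ^ 2 + (cb * db) ^ 2 = (1 + q * sb ^ 2) ^ 2 := by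
    rw [mul_pow cb, a3, a4]
    ring
  have hNe : (((1 + q) * sb : ℝ) : ℂ) + (cb * db : ℝ) * Complex.I ≠ 0 := by
    intro h0
    have h1 := congrArg Complex.re h0
    have h2 := congrArg Complex.im h0
    simp [-Complex.ofReal_mul, -Complex.ofReal_add] at h1 h2
    have hcd : cb * db = 0 := by simpa using h2
    have hsb : (1 + q) * sb = 0 := by simpa using h1
    rw [hcd, hsb] at unit
    have := pow_pos hB 2
    linarith
  have hx0' : (((Real.sqrt q)⁻¹ : ℝ) : ℂ) ≠ 0 := by exact_mod_cast inv_ne_zero hx0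
  have hAc : ((1 + q * sa ^ 2 : ℝ) : ℂ) ≠ 0 := by exact_mod_cast hA.ne'
  have hBc : ((1 + q * sb ^ 2 : ℝ) : ℂ) ≠ 0 := by exact_mod_cast hB.ne'
  have hDc : ((E : ℝ) : ℂ) ≠ 0 := by exact_mod_cast hDne
  rw [mul_div_mul_left _ _ hx0', div_eq_iff (div_ne_zero hNe hBc), map_div₀, Complex.conj_ofReal]
  have unit_c := congrArg Complex.ofReal unit
  have re_c := congrArg Complex.ofReal re_eq
  have im_c := congrArg Complex.ofReal im_eq
  push_cast at unit_c re_c im_c hAc hBc hDc ⊢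
  simp only [map_mul, map_add, Complex.conj_ofReal, Complex.conj_I]
  field_simp
  have key : -(((C * (q * S') : ℂ) + D' * -Complex.I) * ((D * S' : ℂ) + C' * -Complex.I)) *
      ((1 + q * sa ^ 2) * (1 + q * sb ^ 2)) =
      E * ((((1 + q) * sa : ℂ) + (ca * da) * Complex.I) *
        (((1 + q) * sb : ℂ) - (cb * db) * Complex.I)) := by
    linear_combination im_c * Complex.I - re_c +
      (E * ca * da * cb * db - C' * D' * ((1 + q * sa ^ 2) * (1 + q * sb ^ 2))) * Complex.I_sq
  apply mul_right_cancel₀ hBc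
  linear_combination (-((1 + q) * sb + (cb * db) * Complex.I : ℂ)) * key -
    ((1 + q) * sa + (ca * da) * Complex.I : ℂ) * E * unit_c +
    ((1 + q) * sa + (ca * da) * Complex.I : ℂ) * E * (cb * db) ^ 2 * Complex.I_sq

/-! ### Uniformizing variables -/

lemma exists_uniformizing {q r R : ℝ} (hq : 0 < q) (hq' : q < 1) (hr : |r| ≤ Real.pi)
    (hR : 0 ≤ R) (hR' : R ≤ Real.pi) (h : q * Real.cos r = Real.cos R) :
    ∃ β ∈ Set.Icc 0 (4 * ellipticK q), Uniformizes q β r R := by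
  -- The amplitude of β is π/2 - r, raised by 2π when negative so that it lies in [0, 2π].
  have hθ : ∃ θ ∈ Set.Icc 0 (2 * Real.pi), Real.cos r = Real.sin θ ∧ Real.sin r = Real.cos θ := by
    have hpi := Real.pi_pos
    obtain ⟨h1, h2⟩ := abs_le.1 hr
    rcases le_or_gt r (Real.pi / 2) with h3 | h3
    · exact ⟨Real.pi / 2 - r, ⟨by linarith, by linarith⟩, (Real.sin_pi_div_two_sub r).symm,
        (Real.cos_pi_div_two_sub r).symm⟩
    · exact ⟨Real.pi / 2 - r + 2 * Real.pi, ⟨by linarith, by linarith⟩,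
        by rw [Real.sin_add_two_pi, Real.sin_pi_div_two_sub],
        by rw [Real.cos_add_two_pi, Real.cos_pi_div_two_sub]⟩
  obtain ⟨θ, ⟨h1, h2⟩, hs, hc⟩ := hθ
  have hmono := (strictMono_ellipticF hq.le hq').monotone
  refine ⟨ellipticF q θ, ⟨?_, ?_⟩, h, ?_, ?_, ?_⟩
  · simpa using hmono h1
  · rw [← ellipticF_two_pi hq.le hq']
    exact hmono h2
  · rw [realSn, jacobiAm_ellipticF hq.le hq', hs]
  · rw [realCn, jacobiAm_ellipticF hq.le hq', hc]
  · rw [realDn, realSn, jacobiAm_ellipticF hq.le hq', ← hs, ← mul_pow, h, ← Real.sin_sq,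
      Real.sqrt_sq (Real.sin_nonneg_of_nonneg_of_le_pi hR hR')]

/-! ### Flat connections on simply connected complexes -/

/-- The product of the values of `g` along a walk. -/
def holonomy {V G : Type*} [Group G] {Γ : SimpleGraph V} (g : V → V → G) :
    ∀ {u v : V}, Γ.Walk u v → G
  | _, _, SimpleGraph.Walk.nil => 1
  | u, _, SimpleGraph.Walk.cons (v := v) _ p => g u v * holonomy g p

lemma holonomy_append {V G : Type*} [Group G] {Γ : SimpleGraph V} (g : V → V → G) {u v w : V}
    (p : Γ.Walk u v) (p' : Γ.Walk v w) :
    holonomy g (p.append p') = holonomy g p * holonomy g p' := by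
  induction p with
  | nil => simp [holonomy]
  | cons h p ih => simp [holonomy, ih, mul_assoc]

lemma PathHomotopic.holonomy_eq {G : Type*} [Group G] {P : Set (ℤ × ℤ)}
    {g : ℤ × ℤ → ℤ × ℤ → G}
    (hinv : ∀ x y, (edgeGraph P).Adj x y → g x y * g y x = 1)
    (hsq : ∀ s ∈ P, ∀ a ∈ corners s, ∀ b ∈ corners s, ∀ c ∈ corners s, ∀ d ∈ corners s,
      (edgeGraph P).Adj a b → (edgeGraph P).Adj b c → (edgeGraph P).Adj a d →
      (edgeGraph P).Adj d c → g a b * g b c = g a d * g d c)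
    {u v : ℤ × ℤ} {p p' : (edgeGraph P).Walk u v} (h : PathHomotopic P p p') :
    holonomy g p = holonomy g p' := by
  induction h with
  | refl => rfl
  | symm _ ih => exact ih.symm
  | trans _ _ ih ih' => exact ih.trans ih'
  | cons h _ ih => simp only [holonomy, ih]
  | spur h h' p => simp only [holonomy, ← mul_assoc, hinv _ _ h, one_mul]
  | square s hs ha hb hc hd hab hbc had hdc p =>
    simp only [holonomy, ← mul_assoc, hsq s hs _ ha _ hb _ hc _ hd hab hbc had hdc]

/-- The section is the holonomy along any walk from a base point. The choice of walk does not matter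
because closed walks are null-homotopic and the moves of a homotopy preserve holonomy. -/
lemma exists_flat_section {G : Type*} [Group G] {P : Set (ℤ × ℤ)}
    (hP : IsSimplyConnectedComplex P) {g : ℤ × ℤ → ℤ × ℤ → G}
    (hinv : ∀ x y, (edgeGraph P).Adj x y → g x y * g y x = 1)
    (hsq : ∀ s ∈ P, ∀ a ∈ corners s, ∀ b ∈ corners s, ∀ c ∈ corners s, ∀ d ∈ corners s,
      (edgeGraph P).Adj a b → (edgeGraph P).Adj b c → (edgeGraph P).Adj a d →
      (edgeGraph P).Adj d c → g a b * g b c = g a d * g d c) :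
    ∃ F : ℤ × ℤ → G, ∀ x y, (edgeGraph P).Adj x y → F y = F x * g x y := by
  classical
  obtain ⟨⟨u, hu⟩, hconn, htriv⟩ := hP
  have hclosed : ∀ p : (edgeGraph P).Walk u u, holonomy g p = 1 := fun p => by
    rw [(htriv u hu p).holonomy_eq hinv hsq, holonomy]
  refine ⟨fun x => if h : (edgeGraph P).Reachable u x then holonomy g h.some else 1,
    fun x y hxy => ?_⟩
  obtain ⟨⟨s, hs, hx, hy⟩, -⟩ := id hxy
  have hux := hconn u hu x ⟨s, hs, hx⟩
  have huy := hconn u hu y ⟨s, hs, hy⟩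
  simp only [dif_pos hux, dif_pos huy]
  have h1 := hclosed (hux.some.append (SimpleGraph.Walk.cons hxy huy.some.reverse))
  have h2 := hclosed (huy.some.append huy.some.reverse)
  simp only [holonomy_append, holonomy] at h1 h2
  rw [← mul_assoc] at h1
  exact (eq_inv_of_mul_eq_one_left h2).trans (eq_inv_of_mul_eq_one_left h1).symm

/-! ### Directions at a vertex -/

/-- The four unit steps of the lattice, in counter-clockwise order. -/
def step : Fin 4 → ℤ × ℤ := ![(1, 0), (0, 1), (-1, 0), (0, -1)]

/-- The square at `v` between the directions `j` and `j + 1`. -/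
def sector (v : ℤ × ℤ) : Fin 4 → ℤ × ℤ :=
  ![v, (v.1 - 1, v.2), (v.1 - 1, v.2 - 1), (v.1, v.2 - 1)]

lemma step_injective : Function.Injective step := by decide

lemma step_add_two (j : Fin 4) : step (j + 2) = -step j := by revert j; decide

lemma step_add_three (j : Fin 4) : step (j + 3) = -step (j + 1) := by revert j; decide

lemma isInternal_iff (P : Set (ℤ × ℤ)) (v : ℤ × ℤ) : IsInternal P v ↔ ∀ j, sector v j ∈ P := by
  simp [IsInternal, Fin.forall_fin_succ, sector]
  tauto

lemma corners_sector (v : ℤ × ℤ) (j : Fin 4) :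
    v ∈ corners (sector v j) ∧ v + step j ∈ corners (sector v j) ∧
      v + step (j + 1) ∈ corners (sector v j) ∧
      v + step j + step (j + 1) ∈ corners (sector v j) := by
  obtain ⟨m, n⟩ := v
  fin_cases j <;> simp [corners, sector, step] <;> omega

lemma sector_opposite (v : ℤ × ℤ) (j : Fin 4) :
    sector (v + step j + step (j + 1)) (j + 2) = sector v j := by
  obtain ⟨m, n⟩ := v
  fin_cases j <;> simp [sector, step, sub_eq_add_neg]

lemma parity_step (v : ℤ × ℤ) (j : Fin 4) :
    Even ((v + step j).1 + (v + step j).2) ↔ Odd (v.1 + v.2) := by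
  obtain ⟨m, n⟩ := v
  fin_cases j <;> simp [step, parity_simps] <;> grind

lemma parity_step' (v : ℤ × ℤ) (j : Fin 4) :
    Odd ((v + step j).1 + (v + step j).2) ↔ Even (v.1 + v.2) := by
  rw [← Int.not_even_iff_odd, parity_step, Int.not_odd_iff_even]

lemma abs_step (v : ℤ × ℤ) (j : Fin 4) :
    |v.1 - (v + step j).1| + |v.2 - (v + step j).2| = 1 := by
  fin_cases j <;> simp [step]

lemma exists_step {P : Set (ℤ × ℤ)} {x y : ℤ × ℤ} (h : (edgeGraph P).Adj x y) :
    ∃ j, y = x + step j := by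
  have h1 := h.2
  obtain ⟨a, b⟩ := x
  obtain ⟨c, d⟩ := y
  simp only at h1
  rcases le_total 0 (a - c) with h2 | h2 <;> rcases le_total 0 (b - d) with h3 | h3 <;>
    simp only [abs_of_nonneg, abs_of_nonpos, h2, h3] at h1 <;>
    simp [Fin.exists_fin_succ, step] <;> omega

lemma adj_sector {P : Set (ℤ × ℤ)} {v : ℤ × ℤ} {j : Fin 4} (h : sector v j ∈ P) :
    (edgeGraph P).Adj v (v + step j) ∧ (edgeGraph P).Adj v (v + step (j + 1)) ∧
    (edgeGraph P).Adj (v + step j) (v + step j + step (j + 1)) ∧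
    (edgeGraph P).Adj (v + step (j + 1)) (v + step j + step (j + 1)) := by
  obtain ⟨h1, h2, h3, h4⟩ := corners_sector v j
  refine ⟨⟨⟨_, h, h1, h2⟩, abs_step _ _⟩, ⟨⟨_, h, h1, h3⟩, abs_step _ _⟩,
    ⟨⟨_, h, h2, h4⟩, abs_step _ _⟩, ⟨⟨_, h, h3, h4⟩, ?_⟩⟩
  rw [add_right_comm]
  exact abs_step _ _

/-- Two edge paths of length two with common ends in one square either coincide, or are both
back-and-forth, or go around the square on different sides. -/
lemma square_cases {s a b c d : ℤ × ℤ} (ha : a ∈ corners s) (hb : b ∈ corners s)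
    (hc : c ∈ corners s) (hd : d ∈ corners s)
    (hab : |a.1 - b.1| + |a.2 - b.2| = 1) (hbc : |b.1 - c.1| + |b.2 - c.2| = 1)
    (had : |a.1 - d.1| + |a.2 - d.2| = 1) (hdc : |d.1 - c.1| + |d.2 - c.2| = 1) :
    b = d ∨ a = c ∨ ∃ j, s = sector a j ∧ c = a + step j + step (j + 1) ∧
      ((b = a + step j ∧ d = a + step (j + 1)) ∨ (d = a + step j ∧ b = a + step (j + 1))) := by
  obtain ⟨m, n⟩ := s
  simp only [corners, Set.mem_insert_iff, Set.mem_singleton_iff] at ha hb hc hd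
  rcases ha with rfl | rfl | rfl | rfl <;> rcases hb with rfl | rfl | rfl | rfl <;>
    simp at hab <;> rcases hd with rfl | rfl | rfl | rfl <;>
    simp at had <;> rcases hc with rfl | rfl | rfl | rfl <;>
    simp at hbc hdc <;> simp [Fin.exists_fin_succ, step, sector]

/-- On a 4-cycle the only obstruction is the total product, and it matters only if all four links
are imposed. -/
lemma exists_potential {G : Type*} [CommGroup G] (p : Fin 4 → Prop) (e : Fin 4 → G)
    (h : (∀ j, p j) → ∏ j, e j = 1) : ∃ a : Fin 4 → G, ∀ j, p j → a (j + 1) = a j * e j := by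
  by_cases hall : ∀ j, p j
  · have h1 := h hall
    rw [Fin.prod_univ_four] at h1
    refine ⟨![1, e 0, e 0 * e 1, e 0 * e 1 * e 2], fun j _ => ?_⟩
    fin_cases j <;> simp [h1]
  · push Not at hall
    -- Cut the cycle at the missing link `i`: start with 1 at `i + 1` and multiply onwards.
    obtain ⟨i, hi⟩ := hall
    fin_cases i
    · refine ⟨![e 1 * e 2 * e 3, 1, e 1, e 1 * e 2], fun j hj => ?_⟩
      fin_cases j <;> first | exact absurd hj hi | simp
    · refine ⟨![e 2 * e 3, e 2 * e 3 * e 0, 1, e 2], fun j hj => ?_⟩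
      fin_cases j <;> first | exact absurd hj hi | simp
    · refine ⟨![e 3, e 3 * e 0, e 3 * e 0 * e 1, 1], fun j hj => ?_⟩
      fin_cases j <;> first | exact absurd hj hi | simp
    · refine ⟨![1, e 0, e 0 * e 1, e 0 * e 1 * e 2], fun j hj => ?_⟩
      fin_cases j <;> first | exact absurd hj hi | simp

/-! ### Frames of the sphere -/

/-- The rotation group of `ℝ³`; a rotation is identified with the positive orthonormal frame
formed by its columns. -/
abbrev SO3 := Matrix.specialOrthogonalGroup (Fin 3) ℝ

/-- The first vector of a frame. -/
def origin (A : SO3) : Fin 3 → ℝ := (A : Matrix (Fin 3) (Fin 3) ℝ) *ᵥ ![1, 0, 0]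

lemma mem_SO3 {A : Matrix (Fin 3) (Fin 3) ℝ} (h : Aᵀ * A = 1) (hd : A.det = 1) :
    A ∈ Matrix.specialOrthogonalGroup (Fin 3) ℝ :=
  Matrix.mem_specialOrthogonalGroup_iff.2 ⟨(Matrix.mem_orthogonalGroup_iff' _ _).2 h, hd⟩

lemma SO3_transpose_mul (A : SO3) : (A : Matrix (Fin 3) (Fin 3) ℝ)ᵀ * A = 1 :=
  (Matrix.mem_orthogonalGroup_iff' _ _).1 (Matrix.mem_specialOrthogonalGroup_iff.1 A.2).1

lemma SO3_det (A : SO3) : (A : Matrix (Fin 3) (Fin 3) ℝ).det = 1 :=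
  (Matrix.mem_specialOrthogonalGroup_iff.1 A.2).2

lemma SO3_mulVec_injective (A : SO3) :
    Function.Injective ((A : Matrix (Fin 3) (Fin 3) ℝ) *ᵥ ·) := by
  intro x y h
  have := congrArg ((A : Matrix (Fin 3) (Fin 3) ℝ)ᵀ *ᵥ ·) h
  simpa [Matrix.mulVec_mulVec, SO3_transpose_mul A] using this

lemma coe_mul_mulVec (A B : SO3) (x : Fin 3 → ℝ) :
    ((A * B : SO3) : Matrix (Fin 3) (Fin 3) ℝ) *ᵥ x =
      (A : Matrix (Fin 3) (Fin 3) ℝ) *ᵥ ((B : Matrix (Fin 3) (Fin 3) ℝ) *ᵥ x) := by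
  rw [Submonoid.coe_mul, Matrix.mulVec_mulVec]

lemma Circle.re_sq_add_im_sq (z : Circle) : (z : ℂ).re ^ 2 + (z : ℂ).im ^ 2 = 1 := by
  have := Circle.normSq_coe z
  rw [Complex.normSq_apply] at this
  linarith

/-- Rotation of a frame about its first vector. -/
def spin : Circle →* SO3 where
  toFun z := ⟨!![1, 0, 0; 0, (z : ℂ).re, -(z : ℂ).im; 0, (z : ℂ).im, (z : ℂ).re], by
    have h := Circle.re_sq_add_im_sq z
    refine mem_SO3 ?_ ?_
    · ext i j
      fin_cases i <;> fin_cases j <;> simp [Matrix.mul_apply, Fin.sum_univ_three] <;> linarith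
    · simp [Matrix.det_fin_three]
      linarith⟩
  map_one' := by
    ext i j
    fin_cases i <;> fin_cases j <;> simp
  map_mul' z w := by
    ext i j
    fin_cases i <;> fin_cases j <;> simp <;> ring

/-- Transport of a frame by `-ρ` along the geodesic in the direction of its second vector. -/
def tilt (ρ : ℝ) : SO3 :=
  ⟨!![Real.cos ρ, Real.sin ρ, 0; -Real.sin ρ, Real.cos ρ, 0; 0, 0, 1], by
    have h := Real.sin_sq_add_cos_sq ρ
    refine mem_SO3 ?_ ?_
    · ext i j
      fin_cases i <;> fin_cases j <;> simp [Matrix.mul_apply, Fin.sum_univ_three] <;> linarith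
    · simp [Matrix.det_fin_three]
      linarith⟩

lemma spin_mulVec (z : Circle) (x : ℝ) (w : ℂ) :
    (spin z : Matrix (Fin 3) (Fin 3) ℝ) *ᵥ ![x, w.re, w.im] =
      ![x, (z * w : ℂ).re, (z * w : ℂ).im] := by
  ext i
  fin_cases i <;> simp [spin, Matrix.mulVec, dotProduct, Fin.sum_univ_three] <;> ring

lemma spin_injective : Function.Injective spin := by
  intro z w h
  have h1 := congrArg (fun A : SO3 => (A : Matrix (Fin 3) (Fin 3) ℝ) 1 1) h
  have h2 := congrArg (fun A : SO3 => (A : Matrix (Fin 3) (Fin 3) ℝ) 2 1) h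
  exact Circle.ext (Complex.ext (by simpa [spin] using h1) (by simpa [spin] using h2))

lemma origin_mul_spin (A : SO3) (z : Circle) : origin (A * spin z) = origin A := by
  have := spin_mulVec z 1 0
  simp only [mul_zero, Complex.zero_re, Complex.zero_im] at this
  simp only [origin, coe_mul_mulVec, this]

/-- The quotient of the two frames fixes the first basis vector, so it is a plane rotation in the
other two coordinates. -/
lemma exists_spin {A B : SO3} (h : origin A = origin B) : ∃ z, B = A * spin z := by
  suffices H : ∀ G : SO3, origin G = ![1, 0, 0] → ∃ z, G = spin z by
    obtain ⟨z, hz⟩ := H (A⁻¹ * B) (by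
      have e : origin (A⁻¹ * B) = ((A⁻¹ : SO3) : Matrix (Fin 3) (Fin 3) ℝ) *ᵥ origin B := by
        simp only [origin, Submonoid.coe_mul, Matrix.mulVec_mulVec]
      rw [e, ← h]
      simp only [origin, Matrix.mulVec_mulVec, ← Submonoid.coe_mul, inv_mul_cancel]
      simp)
    exact ⟨z, by rw [← hz, mul_inv_cancel_left]⟩
  intro G hG
  have h0 := congrFun hG 0
  have h1 := congrFun hG 1
  have h2 := congrFun hG 2
  simp [origin, Matrix.mulVec, dotProduct, Fin.sum_univ_three] at h0 h1 h2
  have hT := SO3_transpose_mul G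
  have hd := SO3_det G
  have e := fun i j => congrFun (congrFun hT i) j
  simp only [Matrix.mul_apply, Fin.sum_univ_three, Matrix.transpose_apply] at e
  have e01 := e 0 1
  have e02 := e 0 2
  have e11 := e 1 1
  have e12 := e 1 2
  have e22 := e 2 2
  simp [h0, h1, h2] at e01 e02 e11 e12 e22
  rw [Matrix.det_fin_three] at hd
  simp [h0, h1, h2, e01, e02] at hd e11 e12 e22
  have f1 : (G : Matrix (Fin 3) (Fin 3) ℝ) 2 2 = (G : Matrix (Fin 3) (Fin 3) ℝ) 1 1 := by grind
  have f2 : (G : Matrix (Fin 3) (Fin 3) ℝ) 1 2 = -(G : Matrix (Fin 3) (Fin 3) ℝ) 2 1 := by grind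
  have hz : (⟨(G : Matrix (Fin 3) (Fin 3) ℝ) 1 1, (G : Matrix (Fin 3) (Fin 3) ℝ) 2 1⟩ : ℂ) ∈
      Submonoid.unitSphere ℂ := by
    refine mem_sphere_zero_iff_norm.2 ?_
    rw [← pow_left_inj₀ (norm_nonneg _) zero_le_one two_ne_zero, ← Complex.normSq_eq_norm_sq,
      Complex.normSq_mk]
    linarith
  refine ⟨⟨_, hz⟩, ?_⟩
  ext i j
  fin_cases i <;> fin_cases j <;> simp [spin, h0, h1, h2, e01, e02, f1, f2]

/-- The imaginary unit on the circle. -/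
def circleI : Circle := ⟨Complex.I, mem_sphere_zero_iff_norm.2 Complex.norm_I⟩

@[simp] lemma coe_circleI : (circleI : ℂ) = Complex.I := rfl

@[simp] lemma coe_circleI_inv : ((circleI⁻¹ : Circle) : ℂ) = -Complex.I := by simp

/-! ### The angle of a ring at a square -/

/-- The angle at the center of a ring in the quadrilateral formed by the centers of two neighboring
rings and their two common points. The ring has radii `ρ`, `σ` at the two points, the neighbor has
radii `σ'`, `ρ'` there. -/
def ringAngle (ρ σ ρ' σ' : ℝ) : Circle :=
  Circle.exp (Complex.arg ⟨Real.sin ρ * Real.cos σ', Real.sin σ'⟩ +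
    Complex.arg ⟨Real.sin σ * Real.cos ρ', Real.sin ρ'⟩)

lemma ringAngle_swap (ρ σ ρ' σ' : ℝ) : ringAngle σ ρ σ' ρ' = ringAngle ρ σ ρ' σ' := by
  rw [ringAngle, ringAngle, add_comm]

lemma normSq_leg (ρ σ : ℝ) : ‖(⟨Real.sin ρ * Real.cos σ, Real.sin σ⟩ : ℂ)‖ ^ 2 =
    1 - (Real.cos ρ * Real.cos σ) ^ 2 := by
  rw [← Complex.normSq_eq_norm_sq, Complex.normSq_mk]
  have h1 := Real.sin_sq ρ
  have h2 := Real.sin_sq σ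
  linear_combination (Real.cos σ ^ 2) * h1 + h2

lemma norm_mul_exp_arg (z : ℂ) : (‖z‖ : ℂ) * (Circle.exp z.arg : ℂ) = z := by
  rw [Circle.coe_exp, Complex.norm_mul_exp_arg_mul_I]

section

variable {ρ σ ρ' σ' : ℝ}

/-- The two legs have the same modulus, since both squared moduli are 1 minus the squared cosine of
the distance between the centers. The product of their phases is therefore their product divided by
that square. -/
lemma ringAngle_coe (h : Real.cos ρ * Real.cos σ' = Real.cos σ * Real.cos ρ')
    (h1 : (Real.cos ρ * Real.cos σ') ^ 2 < 1) :
    (ringAngle ρ σ ρ' σ' : ℂ) = (⟨Real.sin ρ * Real.cos σ', Real.sin σ'⟩ : ℂ) *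
      ⟨Real.sin σ * Real.cos ρ', Real.sin ρ'⟩ / ((1 - (Real.cos ρ * Real.cos σ') ^ 2 : ℝ) : ℂ) := by
  have n1 := normSq_leg ρ σ'
  have n2 := normSq_leg σ ρ'
  rw [← h, ← n1] at n2
  have n3 := (pow_left_inj₀ (norm_nonneg _) (norm_nonneg _) two_ne_zero).1 n2
  rw [← n1, eq_div_iff (by
    rw [n1]
    exact_mod_cast (by linarith : (1 - (Real.cos ρ * Real.cos σ') ^ 2 : ℝ) ≠ 0)), ringAngle,
    Circle.exp_add, Circle.coe_mul]
  conv_rhs => rw [← norm_mul_exp_arg ⟨Real.sin ρ * Real.cos σ', Real.sin σ'⟩,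
    ← norm_mul_exp_arg ⟨Real.sin σ * Real.cos ρ', Real.sin ρ'⟩, n3]
  push_cast
  ring

lemma ringAngle_mul (h : Real.cos ρ * Real.cos σ' = Real.cos σ * Real.cos ρ')
    (h1 : (Real.cos ρ * Real.cos σ') ^ 2 < 1) :
    (ringAngle ρ σ ρ' σ' : ℂ) * ⟨Real.sin σ * Real.cos ρ', -Real.sin ρ'⟩ =
      ⟨Real.sin ρ * Real.cos σ', Real.sin σ'⟩ := by
  rw [ringAngle_coe h h1, div_mul_eq_mul_div, div_eq_iff (by
    exact_mod_cast (by linarith : (1 - (Real.cos ρ * Real.cos σ') ^ 2 : ℝ) ≠ 0)), mul_assoc]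
  congr 1
  have n2 := normSq_leg σ ρ'
  rw [← h, ← Complex.normSq_eq_norm_sq] at n2
  rw [← n2, ← Complex.mul_conj]
  rfl

/-- Coordinates of the neighbor's center in the frame at the ring's center. The last two, read as a
complex number, have as argument the angle of the right triangle at that center. -/
lemma origin_turn (A : SO3) (ρ σ : ℝ) :
    origin (A * spin circleI⁻¹ * tilt σ) = ((A * tilt ρ : SO3) : Matrix (Fin 3) (Fin 3) ℝ) *ᵥ
      ![Real.cos ρ * Real.cos σ, Real.sin ρ * Real.cos σ, Real.sin σ] := by
  have h := Real.sin_sq_add_cos_sq ρ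
  simp only [origin, coe_mul_mulVec]
  congr 1
  ext i
  fin_cases i <;> simp [spin, tilt, Matrix.mulVec, dotProduct, Fin.sum_univ_three] <;>
    first | linear_combination -Real.cos σ * h | ring

lemma origin_turn' (A : SO3) (ρ σ : ℝ) :
    origin (A * spin circleI * tilt σ) = ((A * tilt ρ : SO3) : Matrix (Fin 3) (Fin 3) ℝ) *ᵥ
      ![Real.cos ρ * Real.cos σ, Real.sin ρ * Real.cos σ, -Real.sin σ] := by
  have h := Real.sin_sq_add_cos_sq ρ
  simp only [origin, coe_mul_mulVec]
  congr 1
  ext i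
  fin_cases i <;> simp [spin, tilt, Matrix.mulVec, dotProduct, Fin.sum_univ_three] <;>
    first | linear_combination -Real.cos σ * h | ring

/-- Frames at the two common points of two neighboring rings determine the same centers of the rings
if and only if they differ by the angle of the ring. -/
lemma origin_eq_iff (h : Real.cos ρ * Real.cos σ' = Real.cos σ * Real.cos ρ')
    (h1 : (Real.cos ρ * Real.cos σ') ^ 2 < 1) (A B : SO3) :
    (origin (A * tilt ρ) = origin (B * tilt σ) ∧
      origin (A * spin circleI⁻¹ * tilt σ') = origin (B * spin circleI * tilt ρ')) ↔
    B * tilt σ = A * tilt ρ * spin (ringAngle ρ σ ρ' σ') := by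
  rw [origin_turn A ρ σ', origin_turn' B σ ρ', ← h]
  have hm := spin_mulVec (ringAngle ρ σ ρ' σ') (Real.cos ρ * Real.cos σ')
    ⟨Real.sin σ * Real.cos ρ', -Real.sin ρ'⟩
  rw [ringAngle_mul h h1] at hm
  constructor
  · rintro ⟨h2, h3⟩
    obtain ⟨z, hz⟩ := exists_spin h2
    rw [hz]
    congr 2
    rw [hz, coe_mul_mulVec (A * tilt ρ)] at h3
    have h4 := SO3_mulVec_injective (A * tilt ρ) h3
    have h5 := spin_mulVec z (Real.cos ρ * Real.cos σ')
      ⟨Real.sin σ * Real.cos ρ', -Real.sin ρ'⟩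
    simp only at h5
    rw [h5] at h4
    have h6 : (⟨Real.sin ρ * Real.cos σ', Real.sin σ'⟩ : ℂ) =
        z * ⟨Real.sin σ * Real.cos ρ', -Real.sin ρ'⟩ :=
      Complex.ext (congrFun h4 1) (congrFun h4 2)
    rw [← ringAngle_mul h h1] at h6
    refine (Circle.ext (mul_right_cancel₀ ?_ h6)).symm
    -- The complex number to be cancelled is nonzero because the centers are neither equal nor
    -- antipodal.
    intro h0
    have h7 := ringAngle_mul h h1
    have n1 := normSq_leg ρ σ'
    rw [h0, mul_zero] at h7
    rw [← h7] at n1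
    simp at n1
    linarith
  · intro h2
    refine ⟨by rw [h2, origin_mul_spin], ?_⟩
    rw [h2, coe_mul_mulVec (A * tilt ρ)]
    simp only at hm
    rw [hm]

end

/-! ### Connections given by directions at even vertices -/

/-- The function on directed edges whose value on the edge from an even vertex `v` in the direction
`j` is `M v j`, extended to the reversed edges by inversion. -/
def stepConnection {G : Type*} [Group G] (M : ℤ × ℤ → Fin 4 → G) (x y : ℤ × ℤ) : G :=
  open scoped Classical in
  if Even (x.1 + x.2) then
    if h : ∃ j, y = x + step j then M x h.choose else 1
  else
    if h : ∃ j, x = y + step j then (M y h.choose)⁻¹ else 1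

lemma stepConnection_even {G : Type*} [Group G] (M : ℤ × ℤ → Fin 4 → G) {v : ℤ × ℤ}
    (hv : Even (v.1 + v.2)) (j : Fin 4) : stepConnection M v (v + step j) = M v j := by
  have h : ∃ i, v + step j = v + step i := ⟨j, rfl⟩
  rw [stepConnection, if_pos hv, dif_pos h, ← step_injective (add_left_cancel h.choose_spec)]

lemma stepConnection_odd {G : Type*} [Group G] (M : ℤ × ℤ → Fin 4 → G) {v : ℤ × ℤ}
    (hv : Even (v.1 + v.2)) (j : Fin 4) : stepConnection M (v + step j) v = (M v j)⁻¹ := by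
  have h : ∃ i, v + step j = v + step i := ⟨j, rfl⟩
  have hw : ¬ Even ((v + step j).1 + (v + step j).2) := by
    rw [parity_step, Int.not_odd_iff_even]
    exact hv
  rw [stepConnection, if_neg hw, dif_pos h, ← step_injective (add_left_cancel h.choose_spec)]

lemma opposite_step_two (v : ℤ × ℤ) (j : Fin 4) :
    v + step j + step (j + 1) + step (j + 2) = v + step (j + 1) := by
  rw [step_add_two]
  abel

lemma opposite_step_three (v : ℤ × ℤ) (j : Fin 4) :
    v + step j + step (j + 1) + step (j + 3) = v + step j := by
  rw [step_add_three]
  abel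

lemma parity_opposite {v : ℤ × ℤ} (hv : Even (v.1 + v.2)) (j : Fin 4) :
    Even ((v + step j + step (j + 1)).1 + (v + step j + step (j + 1)).2) := by
  rw [parity_step, parity_step']
  exact hv

/-- Flatness is required only around squares as seen from their even corners; inverting edges
supplies the rest. -/
lemma exists_section_of_steps {G : Type*} [Group G] {P : Set (ℤ × ℤ)}
    (hP : IsSimplyConnectedComplex P) (M : ℤ × ℤ → Fin 4 → G)
    (hM : ∀ v, Even (v.1 + v.2) → ∀ j, sector v j ∈ P →
      M v j * (M (v + step j + step (j + 1)) (j + 3))⁻¹ =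
        M v (j + 1) * (M (v + step j + step (j + 1)) (j + 2))⁻¹) :
    ∃ F : ℤ × ℤ → G, ∀ v, Even (v.1 + v.2) → ∀ j, (edgeGraph P).Adj v (v + step j) →
      F (v + step j) = F v * M v j := by
  have hinv : ∀ x y, (edgeGraph P).Adj x y → stepConnection M x y * stepConnection M y x = 1 := by
    intro x y h
    obtain ⟨j, rfl⟩ := exists_step h
    by_cases hx : Even (x.1 + x.2)
    · rw [stepConnection_even M hx, stepConnection_odd M hx, mul_inv_cancel]
    · obtain ⟨i, hi⟩ := exists_step h.symm
      have hy := (parity_step x j).2 (Int.not_even_iff_odd.1 hx)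
      generalize x + step j = y at *
      subst hi
      rw [stepConnection_even M hy, stepConnection_odd M hy, inv_mul_cancel]
  have heven : ∀ v, Even (v.1 + v.2) → ∀ j, sector v j ∈ P →
      stepConnection M v (v + step j) *
          stepConnection M (v + step j) (v + step j + step (j + 1)) =
        stepConnection M v (v + step (j + 1)) *
          stepConnection M (v + step (j + 1)) (v + step j + step (j + 1)) := by
    intro v hv j hj
    have h1 := stepConnection_odd M (parity_opposite hv j) (j + 3)
    have h2 := stepConnection_odd M (parity_opposite hv j) (j + 2)
    rw [opposite_step_three] at h1
    rw [opposite_step_two] at h2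
    rw [stepConnection_even M hv, stepConnection_even M hv, h1, h2]
    exact hM v hv j hj
  have hall : ∀ v j, sector v j ∈ P →
      stepConnection M v (v + step j) *
          stepConnection M (v + step j) (v + step j + step (j + 1)) =
        stepConnection M v (v + step (j + 1)) *
          stepConnection M (v + step (j + 1)) (v + step j + step (j + 1)) := by
    intro v j hj
    by_cases hv : Even (v.1 + v.2)
    · exact heven v hv j hj
    -- From an odd corner, view the same square from the adjacent even corner `v + step (j + 1)`,
    -- where it lies between directions `j + 3` and `j`, and cancel back-and-forth steps.
    · have hw : Even ((v + step (j + 1)).1 + (v + step (j + 1)).2) :=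
        (parity_step v _).2 (Int.not_even_iff_odd.1 hv)
      have e1 : v + step (j + 1) + step (j + 3) = v := by rw [step_add_three]; abel
      have e0 : j + 3 + 1 = j := by fin_cases j <;> rfl
      have e2 : v + step (j + 1) + step j = v + step j + step (j + 1) := by abel
      have hs : sector (v + step (j + 1)) (j + 3) = sector v j := by
        obtain ⟨m, n⟩ := v
        fin_cases j <;> simp [sector, step, sub_eq_add_neg]
      have h := heven _ hw (j + 3) (hs ▸ hj)
      rw [e0, e1, e2] at h
      obtain ⟨a1, a2, a3, a4⟩ := adj_sector hj
      have i1 := hinv _ _ a2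
      have i2 := hinv _ _ a3
      calc _ = stepConnection M v (v + step (j + 1)) *
              (stepConnection M (v + step (j + 1)) v * stepConnection M v (v + step j)) *
              stepConnection M (v + step j) (v + step j + step (j + 1)) := by
            rw [← mul_assoc, i1, one_mul]
        _ = _ := by
            rw [h, mul_assoc, mul_assoc, hinv _ _ a3.symm, mul_one]
  obtain ⟨F, hF⟩ := exists_flat_section hP hinv (by
    intro s hs a ha b hb c hc d hd hab hbc had hdc
    rcases square_cases ha hb hc hd hab.2 hbc.2 had.2 hdc.2 with
      rfl | rfl | ⟨j, rfl, rfl, ⟨rfl, rfl⟩ | ⟨rfl, rfl⟩⟩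
    · rfl
    · rw [hinv _ _ hab, hinv _ _ had]
    · exact hall a j hs
    · exact (hall a j hs).symm)
  exact ⟨F, fun v hv j h => by rw [hF _ _ h, stepConnection_even M hv]⟩

/-! ### Patterns in terms of frames -/

/-- A column of a frame. -/
def column (A : SO3) (i : Fin 3) : Fin 3 → ℝ := fun t => (A : Matrix (Fin 3) (Fin 3) ℝ) t i

lemma column_two (A : SO3) : column A 2 = column A 0 ⨯₃ column A 1 := by
  have h1 := SO3_transpose_mul A
  have h2 : (A : Matrix (Fin 3) (Fin 3) ℝ).adjugate = (A : Matrix (Fin 3) (Fin 3) ℝ)ᵀ := by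
    have h3 := Matrix.mul_adjugate (A : Matrix (Fin 3) (Fin 3) ℝ)
    rw [SO3_det, one_smul] at h3
    calc _ = ((A : Matrix (Fin 3) (Fin 3) ℝ)ᵀ * A) * (A : Matrix (Fin 3) (Fin 3) ℝ).adjugate := by
          rw [h1, one_mul]
      _ = _ := by rw [mul_assoc, h3, mul_one]
  have e := fun t => congrFun (congrFun h2 2) t
  have e0 := e 0
  have e1 := e 1
  have e2 := e 2
  simp [Matrix.adjugate_fin_three] at e0 e1 e2
  ext t
  fin_cases t <;> simp [column, cross_apply] <;> linarith

lemma isUnitTangent_column (A : SO3) : IsUnitTangent (column A 0) (column A 1) := by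
  have e := fun i j => congrFun (congrFun (SO3_transpose_mul A) i) j
  simp only [Matrix.mul_apply, Matrix.transpose_apply] at e
  exact ⟨e 0 0, e 1 1, e 0 1⟩

lemma exists_frame {p n : Fin 3 → ℝ} (h : IsUnitTangent p n) :
    ∃ A : SO3, column A 0 = p ∧ column A 1 = n := by
  obtain ⟨h1, h2, h3⟩ := h
  simp only [unitSphere, Set.mem_ofPred_eq, dotProduct, Fin.sum_univ_three] at h1 h2 h3
  refine ⟨⟨!![p 0, n 0, (p ⨯₃ n) 0; p 1, n 1, (p ⨯₃ n) 1; p 2, n 2, (p ⨯₃ n) 2],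
    mem_SO3 ?_ ?_⟩, ?_, ?_⟩
  · ext i j
    fin_cases i <;> fin_cases j <;>
      simp [Matrix.mul_apply, Fin.sum_univ_three, cross_apply] <;> grind
  · simp [Matrix.det_fin_three, cross_apply]
    grind
  · ext t
    fin_cases t <;> simp [column]
  · ext t
    fin_cases t <;> simp [column]

lemma origin_mem_unitSphere (A : SO3) : origin A ∈ unitSphere := by
  have e : origin A = column A 0 := by
    ext t
    simp [origin, column, Matrix.mulVec, dotProduct, Fin.sum_univ_three]
  rw [e]
  exact (isUnitTangent_column A).1

/-- The rotation by `j` right angles. -/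
def quarter (j : Fin 4) : Circle := circleI ^ (j : ℕ)

lemma circleI_sq : circleI ^ 2 = -1 := Circle.ext (by simp)

lemma quarter_add_one (j : Fin 4) : quarter (j + 1) = quarter j * circleI := by
  have h : circleI ^ 4 = 1 := by rw [show 4 = 2 * 2 by rfl, pow_mul, circleI_sq]; simp
  fin_cases j <;> simp [quarter, ← pow_succ, ← sq, h]

lemma quarter_add_two (j : Fin 4) : quarter (j + 2) = quarter (j + 1) * circleI := by
  rw [← quarter_add_one, add_assoc]
  rfl

lemma quarter_add_three (j : Fin 4) : quarter (j + 3) = quarter j * circleI⁻¹ := by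
  rw [eq_mul_inv_iff_mul_eq, ← quarter_add_one, add_assoc]
  simp [show (3 : Fin 4) + 1 = 0 by rfl]

/-- This is `PassesThrough` with the normal turned by `z`; powers of i give the four normals ±n, ±(ℓ
× n). -/
lemma origin_spin_tilt (A : SO3) (z : Circle) (ρ : ℝ) :
    origin (A * spin z * tilt ρ) = Real.cos ρ • column A 0 -
      Real.sin ρ • ((z : ℂ).re • column A 1 + (z : ℂ).im • column A 2) := by
  simp only [origin, coe_mul_mulVec]
  ext t
  simp [spin, tilt, column, Matrix.mulVec, dotProduct, Fin.sum_univ_three]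
  ring

/-- The radius of the circle of a ring that passes through the next point in direction `j`. -/
def ringRadius (r R : ℝ) (j : Fin 4) : ℝ := ![r, R, r, R] j

lemma ringRadius_add_two (r R : ℝ) (j : Fin 4) : ringRadius r R (j + 2) = ringRadius r R j := by
  fin_cases j <;> rfl

lemma ringRadius_add_three (r R : ℝ) (j : Fin 4) :
    ringRadius r R (j + 3) = ringRadius r R (j + 1) := by
  fin_cases j <;> rfl

/-- Frames `F` at the odd vertices and centers `k` at the even vertices form a pattern. -/
def IsFramePattern (P : Set (ℤ × ℤ)) (r R : ℤ × ℤ → ℝ) (F : ℤ × ℤ → SO3)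
    (k : ℤ × ℤ → Fin 3 → ℝ) : Prop :=
  ∀ v, Even (v.1 + v.2) → ∀ j, (edgeGraph P).Adj v (v + step j) →
    k v = origin (F (v + step j) * spin (quarter j) * tilt (ringRadius (r v) (R v) j))

lemma exists_adj {P : Set (ℤ × ℤ)} {v : ℤ × ℤ} (hv : v ∈ vertices P) :
    ∃ j, (edgeGraph P).Adj v (v + step j) := by
  obtain ⟨⟨m, n⟩, hs, hv⟩ := hv
  have : ∃ j, (m, n) = sector v j := by
    simp only [corners, Set.mem_insert_iff, Set.mem_singleton_iff] at hv
    rcases hv with rfl | rfl | rfl | rfl <;> simp [Fin.exists_fin_succ, sector]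
  obtain ⟨j, hj⟩ := this
  exact ⟨j, (adj_sector (hj ▸ hs)).1⟩

lemma buildGeneralizedRingPattern_iff (P : Set (ℤ × ℤ)) (r R : ℤ × ℤ → ℝ) :
    BuildGeneralizedRingPattern P r R ↔ ∃ F k, IsFramePattern P r R F k := by
  constructor
  · rintro ⟨k, ℓ, n, h⟩
    have hF : ∀ w, ∃ A : SO3, w ∈ oddVertices P → column A 0 = ℓ w ∧ column A 1 = n w := by
      intro w
      by_cases hw : w ∈ oddVertices P
      · obtain ⟨A, hA⟩ := exists_frame (h.frame w hw)
        exact ⟨A, fun _ => hA⟩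
      · exact ⟨1, fun h => absurd h hw⟩
    choose F hF using hF
    refine ⟨F, k, fun v hv j hadj => ?_⟩
    have hw : v + step j ∈ oddVertices P := by
      obtain ⟨⟨s, hs, -, h2⟩, -⟩ := hadj
      exact ⟨⟨s, hs, h2⟩, (parity_step' v j).2 hv⟩
    obtain ⟨h0, h1⟩ := hF _ hw
    rw [origin_spin_tilt, column_two, h0, h1]
    fin_cases j
    · have := h.left _ hw v (by ext <;> simp [step]) hadj.symm
      simpa [PassesThrough, quarter, ringRadius] using this
    · have := h.below _ hw v (by ext <;> simp [step]) hadj.symm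
      simpa [PassesThrough, quarter, ringRadius] using this
    · have := h.right _ hw v (by ext <;> simp [step]) hadj.symm
      simpa [PassesThrough, quarter, ringRadius] using this
    · have := h.above _ hw v (by ext <;> simp [step]) hadj.symm
      simpa [PassesThrough, quarter, ringRadius, pow_succ] using this
  · rintro ⟨F, k, h⟩
    have key : ∀ w ∈ oddVertices P, ∀ j, ∀ v, v + step j = w → (edgeGraph P).Adj w v →
        PassesThrough (k v) (ringRadius (r v) (R v) j) (column (F w) 0)
          ((quarter j : ℂ).re • column (F w) 1 +
            (quarter j : ℂ).im • (column (F w) 0 ⨯₃ column (F w) 1)) := by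
      rintro w ⟨-, hw⟩ j v rfl hadj
      rw [PassesThrough, h v ((parity_step' v j).1 hw) j hadj.symm, origin_spin_tilt, column_two]
    refine ⟨k, fun w => column (F w) 0, fun w => column (F w) 1, ⟨?_, ?_, ?_, ?_, ?_, ?_⟩⟩
    · rintro v ⟨hv, hv'⟩
      obtain ⟨j, hj⟩ := exists_adj hv
      rw [h v hv' j hj]
      exact origin_mem_unitSphere _
    · exact fun w _ => isUnitTangent_column _
    · rintro w hw v rfl hadj
      simpa [quarter, ringRadius] using key w hw 0 _ (by ext <;> simp [step]) hadj
    · rintro w hw v rfl hadj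
      simpa [quarter, ringRadius] using key w hw 2 _ (by ext <;> simp [step]) hadj
    · rintro w hw v rfl hadj
      simpa [quarter, ringRadius] using key w hw 1 _ (by ext <;> simp [step]) hadj
    · rintro w hw v rfl hadj
      simpa [quarter, ringRadius, pow_succ] using key w hw 3 _ (by ext <;> simp [step]) hadj

/-! ### Ring patterns and ring angles -/

lemma mem_evenVertices_sector {P : Set (ℤ × ℤ)} {v : ℤ × ℤ} (hv : Even (v.1 + v.2)) {j : Fin 4}
    (hj : sector v j ∈ P) :
    v ∈ evenVertices P ∧ v + step j + step (j + 1) ∈ evenVertices P := by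
  obtain ⟨h1, -, -, h2⟩ := corners_sector v j
  exact ⟨⟨⟨_, hj, h1⟩, hv⟩, ⟨⟨_, hj, h2⟩, parity_opposite hv j⟩⟩

/-- The two frames at the common points of neighboring rings in a frame pattern. -/
lemma IsFramePattern.square {P : Set (ℤ × ℤ)} {r R : ℤ × ℤ → ℝ} {F : ℤ × ℤ → SO3}
    {k : ℤ × ℤ → Fin 3 → ℝ} (h : IsFramePattern P r R F k) {v v' : ℤ × ℤ}
    (hv : Even (v.1 + v.2)) {j : Fin 4} (hj : sector v j ∈ P)
    (hv' : v' = v + step j + step (j + 1)) {A B : SO3}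
    (hA : A = F (v + step j) * spin (quarter j))
    (hB : B = F (v + step (j + 1)) * spin (quarter (j + 1))) :
    k v = origin (A * tilt (ringRadius (r v) (R v) j)) ∧
    k v = origin (B * tilt (ringRadius (r v) (R v) (j + 1))) ∧
    k v' = origin (A * spin circleI⁻¹ * tilt (ringRadius (r v') (R v') (j + 1))) ∧
    k v' = origin (B * spin circleI * tilt (ringRadius (r v') (R v') j)) := by
  obtain ⟨a1, a2, a3, a4⟩ := adj_sector hj
  subst hA hB
  have h3 := h v' (hv' ▸ parity_opposite hv j) (j + 3)
  have h4 := h v' (hv' ▸ parity_opposite hv j) (j + 2)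
  rw [hv', opposite_step_three, ← hv', ringRadius_add_three, quarter_add_three, map_mul,
    ← mul_assoc] at h3
  rw [hv', opposite_step_two, ← hv', ringRadius_add_two, quarter_add_two, map_mul,
    ← mul_assoc] at h4
  exact ⟨h v hv j a1, h v hv (j + 1) a2, h3 (hv' ▸ a3.symm), h4 (hv' ▸ a4.symm)⟩

lemma SO3_dotProduct (A : SO3) (x y : Fin 3 → ℝ) :
    ((A : Matrix (Fin 3) (Fin 3) ℝ) *ᵥ x) ⬝ᵥ ((A : Matrix (Fin 3) (Fin 3) ℝ) *ᵥ y) = x ⬝ᵥ y := by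
  rw [Matrix.dotProduct_mulVec, Matrix.vecMul_mulVec, ← Matrix.dotProduct_mulVec,
    SO3_transpose_mul, Matrix.one_mulVec]

/-- The distance of the centers of neighboring rings, computed from each of the common points. -/
lemma IsFramePattern.cos_mul_cos {P : Set (ℤ × ℤ)} {r R : ℤ × ℤ → ℝ} {F : ℤ × ℤ → SO3}
    {k : ℤ × ℤ → Fin 3 → ℝ} (h : IsFramePattern P r R F k) {v : ℤ × ℤ}
    (hv : Even (v.1 + v.2)) {j : Fin 4} (hj : sector v j ∈ P) :
    Real.cos (r v) * Real.cos (R (v + step j + step (j + 1))) =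
      Real.cos (R v) * Real.cos (r (v + step j + step (j + 1))) := by
  obtain ⟨h1, h2, h3, h4⟩ := h.square hv hj rfl rfl rfl
  generalize v + step j + step (j + 1) = v' at *
  have e1 : k v ⬝ᵥ k v' = Real.cos (ringRadius (r v) (R v) j) *
      Real.cos (ringRadius (r v') (R v') (j + 1)) := by
    rw [h3, h1, origin_turn _ (ringRadius (r v) (R v) j), origin, SO3_dotProduct]
    simp
  have e2 : k v ⬝ᵥ k v' = Real.cos (ringRadius (r v) (R v) (j + 1)) *
      Real.cos (ringRadius (r v') (R v') j) := by
    rw [h4, h2, origin_turn' _ (ringRadius (r v) (R v) (j + 1)), origin, SO3_dotProduct]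
    simp
  rw [e1] at e2
  fin_cases j <;> simp [ringRadius] at e2 <;> linarith

/-- The angle of the ring at `v` in the quadrilateral that it forms with the ring at `v'`. -/
def vertexAngle (r R : ℤ × ℤ → ℝ) (v v' : ℤ × ℤ) : Circle :=
  ringAngle (r v) (R v) (r v') (R v')

/-- Passing from `j` to `j + 1` interchanges inner and outer radii, and the angle is symmetric under
this exchange. So it depends only on the pair of rings. -/
lemma ringAngle_ringRadius (r R : ℤ × ℤ → ℝ) (v v' : ℤ × ℤ) (j : Fin 4) :
    ringAngle (ringRadius (r v) (R v) j) (ringRadius (r v) (R v) (j + 1))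
      (ringRadius (r v') (R v') j) (ringRadius (r v') (R v') (j + 1)) = vertexAngle r R v v' := by
  have h := ringAngle_swap (r v) (R v) (r v') (R v')
  fin_cases j <;> simp [ringRadius, vertexAngle, h]

section

variable {P : Set (ℤ × ℤ)} {q : ℝ} {β r R : ℤ × ℤ → ℝ}

/-- Both products equal q sn b sn b'. The strict bound, from `modulus_sq_pos`, keeps neighboring
centers from being equal or antipodal, including at q = 1. -/
lemma Uniformizes.cos_ringRadius {q : ℝ} (hq : 0 < q) (hq' : q ≤ 1) {b b' r R r' R' : ℝ}
    (h : Uniformizes q b r R) (h' : Uniformizes q b' r' R') (j : Fin 4) :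
    Real.cos (ringRadius r R j) * Real.cos (ringRadius r' R' (j + 1)) =
      Real.cos (ringRadius r R (j + 1)) * Real.cos (ringRadius r' R' j) ∧
    (Real.cos (ringRadius r R j) * Real.cos (ringRadius r' R' (j + 1))) ^ 2 < 1 := by
  have hD := (isJacobiTriple hq.le hq').modulus_sq_pos b b'
  rw [← h.2.1, ← h'.2.1] at hD
  fin_cases j <;> simp [ringRadius, ← h.1, ← h'.1, -sq_lt_one_iff_abs_lt_one] <;>
    exact ⟨by ring, lt_of_eq_of_lt (by ring) (sub_pos.1 hD)⟩

lemma ringEquation_iff (hq : 0 < q) (hq' : q ≤ 1)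
    (hβ : ∀ v ∈ evenVertices P, Uniformizes q (β v) (r v) (R v)) {v : ℤ × ℤ}
    (hv : v ∈ evenVertices P) (hint : IsInternal P v) :
    RingEquation q β v ↔ ∏ j, vertexAngle r R v (v + step j + step (j + 1)) = 1 := by
  have hfac : ∀ v' ∈ evenVertices P,
      jacobiSn q (((β v - β v' : ℝ) + (ellipticK' q : ℂ) * Complex.I) / 2) /
        jacobiSn q (((β v + β v' : ℝ) + (ellipticK' q : ℂ) * Complex.I) / 2) =
      -(starRingEnd ℂ) (vertexAngle r R v v') := by
    intro v' hv'
    obtain ⟨u1, u2, u3, u4⟩ := hβ v hv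
    obtain ⟨w1, w2, w3, w4⟩ := hβ v' hv'
    obtain ⟨c1, c2⟩ := (hβ v hv).cos_ringRadius hq hq' (hβ v' hv') 0
    simp only [ringRadius, zero_add, Matrix.cons_val_zero, Matrix.cons_val_one] at c1 c2
    rw [jacobiSn_quotient hq hq', vertexAngle, ringAngle_coe c1 c2, ← w1, u2, u3, u4, w2, w3, w4]
    congr 3
    · simp only [← Complex.mk_eq_add_mul_I]
    · push_cast
      ring
  rw [isInternal_iff] at hint
  have hmem := fun j => (mem_evenVertices_sector hv.2 (hint j)).2
  have m0 := hfac _ (hmem 0)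
  have m1 := hfac _ (hmem 1)
  have m2 := hfac _ (hmem 2)
  have m3 := hfac _ (hmem 3)
  rw [← Circle.coe_inj, Fin.prod_univ_four]
  simp only [RingEquation, Finset.prod_product,
    Finset.prod_pair (show (1 : ℤ) ≠ -1 by norm_num)]
  have s0 : v + step 0 + step (0 + 1) = (v.1 + 1, v.2 + 1) := by ext <;> simp [step]
  have s1 : v + step 1 + step (1 + 1) = (v.1 + -1, v.2 + 1) := by ext <;> simp [step]
  have s2 : v + step 2 + step (2 + 1) = (v.1 + -1, v.2 + -1) := by ext <;> simp [step]
  have s3 : v + step 3 + step (3 + 1) = (v.1 + 1, v.2 + -1) := by ext <;> simp [step]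
  rw [s0] at m0 ⊢
  rw [s1] at m1 ⊢
  rw [s2] at m2 ⊢
  rw [s3] at m3 ⊢
  rw [m0, m1, m2, m3, ← (starRingEnd ℂ).injective.eq_iff (b := ((1 : Circle) : ℂ))]
  simp only [Circle.coe_mul, map_mul, Circle.coe_one, map_one]
  refine Eq.congr ?_ rfl
  ring

lemma ringEquation_of_isFramePattern (hq : 0 < q) (hq' : q ≤ 1)
    (hβ : ∀ v ∈ evenVertices P, Uniformizes q (β v) (r v) (R v)) {F : ℤ × ℤ → SO3}
    {k : ℤ × ℤ → Fin 3 → ℝ} (h : IsFramePattern P r R F k) {v : ℤ × ℤ}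
    (hv : v ∈ evenVertices P) (hint : IsInternal P v) : RingEquation q β v := by
  rw [ringEquation_iff hq hq' hβ hv hint]
  rw [isInternal_iff] at hint
  -- The four frames at the center of the ring, one for each touching point; consecutive ones differ
  -- by the angle of the square between them, and after four turns the first returns.
  obtain ⟨B, hB⟩ : ∃ B : Fin 4 → SO3, B = fun j => F (v + step j) * spin (quarter j) *
    tilt (ringRadius (r v) (R v) j) := ⟨_, rfl⟩
  have key : ∀ j, B (j + 1) = B j * spin (vertexAngle r R v (v + step j + step (j + 1))) := by
    intro j
    have hv' := (mem_evenVertices_sector hv.2 (hint j)).2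
    obtain ⟨c1, c2⟩ := (hβ v hv).cos_ringRadius hq hq' (hβ _ hv') j
    obtain ⟨h1, h2, h3, h4⟩ := h.square hv.2 (hint j) rfl rfl rfl
    rw [hB]
    simp only
    rw [← ringAngle_ringRadius _ _ _ _ j]
    exact (origin_eq_iff c1 c2 _ _).1 ⟨h1.symm.trans h2, h3.symm.trans h4⟩
  have k0 := key 0
  have k1 := key 1
  have k2 := key 2
  have k3 := key 3
  apply spin_injective
  rw [map_one, Fin.prod_univ_four, map_mul, map_mul, map_mul, ← mul_right_inj (B 0), mul_one,
    ← mul_assoc, ← mul_assoc, ← mul_assoc, ← k0]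
  change B (1 + 1) = _ at k1
  rw [show (0 : Fin 4) + 1 = 1 by rfl, ← k1, show (1 : Fin 4) + 1 = 2 by rfl, ← k2,
    show (2 : Fin 4) + 1 = 3 by rfl, ← k3]
  rfl

lemma exists_isFramePattern (hP : IsSimplyConnectedComplex P) (hq : 0 < q) (hq' : q ≤ 1)
    (hβ : ∀ v ∈ evenVertices P, Uniformizes q (β v) (r v) (R v))
    (heq : ∀ v ∈ evenVertices P, IsInternal P v → RingEquation q β v) :
    ∃ F k, IsFramePattern P r R F k := by
  have ha : ∀ v, ∃ a : Fin 4 → Circle, Even (v.1 + v.2) → ∀ j, sector v j ∈ P →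
      a (j + 1) = a j * vertexAngle r R v (v + step j + step (j + 1)) := by
    intro v
    by_cases hv : Even (v.1 + v.2)
    · obtain ⟨a, ha⟩ := exists_potential (fun j => sector v j ∈ P)
        (fun j => vertexAngle r R v (v + step j + step (j + 1))) (fun hint => by
          have hv' := (mem_evenVertices_sector hv (hint 0)).1
          have hi := (isInternal_iff P v).2 hint
          exact (ringEquation_iff hq hq' hβ hv' hi).1 (heq v hv' hi))
      exact ⟨a, fun _ => ha⟩
    · exact ⟨1, fun h => absurd h hv⟩
  choose a ha using ha
  obtain ⟨F, hF⟩ := exists_section_of_steps hP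
    -- Transport from a frame at the center of `v` to the touching point: turn to direction `j`,
    -- move out by the radius, undo the `j` quarter turns. The potential `a` records the direction
    -- angles.
    (fun v j => spin (a v j) * (tilt (ringRadius (r v) (R v) j))⁻¹ * (spin (quarter j))⁻¹) (by
    intro v hv j hj
    obtain ⟨hve, hve'⟩ := mem_evenVertices_sector hv hj
    have a1 := ha v hv j hj
    have a2 := ha (v + step j + step (j + 1)) (parity_opposite hv j) (j + 2)
      (by rwa [sector_opposite])
    rw [show j + 2 + 1 = j + 3 by rw [add_assoc]; rfl, opposite_step_two,
      show v + step (j + 1) + step (j + 3) = v by rw [step_add_three]; abel] at a2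
    generalize v + step j + step (j + 1) = v' at *
    obtain ⟨c1, c2⟩ := (hβ v hve).cos_ringRadius hq hq' (hβ v' hve') j
    have c1' := c1
    have c2' := c2
    rw [c1', mul_comm] at c2'
    rw [mul_comm, mul_comm (Real.cos (ringRadius (r v) (R v) (j + 1)))] at c1'
    rw [← ringAngle_ringRadius r R v v' j] at a1
    rw [← ringAngle_ringRadius r R v' v j] at a2
    simp only [quarter_add_one j, quarter_add_two j, quarter_add_three j, ringRadius_add_two,
      ringRadius_add_three, a1, a2, map_mul]
    generalize ringRadius (r v) (R v) j = ρ at *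
    generalize ringRadius (r v) (R v) (j + 1) = σ at *
    generalize ringRadius (r v') (R v') j = ρ' at *
    generalize ringRadius (r v') (R v') (j + 1) = σ' at *
    obtain ⟨A, hA⟩ : ∃ A : SO3, A = spin (quarter j) := ⟨_, rfl⟩
    rw [← hA]
    generalize spin (a v j) = x at *
    generalize spin (a v' (j + 2)) = y at *
    obtain ⟨B, hB⟩ : ∃ B : SO3, B = A * tilt ρ * spin (ringAngle ρ σ ρ' σ') * (tilt σ)⁻¹ :=
      ⟨_, rfl⟩
    obtain ⟨h1, h2⟩ := (origin_eq_iff c1 c2 A B).2 (by rw [hB, inv_mul_cancel_right])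
    -- The same quadrilateral seen from the other ring. The angle at `v` makes both pairs of centers
    -- agree, which forces the angle at `v'`; this is the flatness of the square.
    have h3 := (origin_eq_iff c1'.symm c2' (B * spin circleI) (A * spin circleI⁻¹)).1
      ⟨h2.symm, by
        rw [map_inv, mul_inv_cancel_right, inv_mul_cancel_right]
        exact h1.symm⟩
    rw [map_inv] at h3
    have h4 : A * (spin circleI)⁻¹ * tilt σ' * (spin (ringAngle ρ' σ' ρ σ))⁻¹ =
        B * spin circleI * tilt ρ' := by rw [h3, mul_inv_cancel_right]
    have h5 : x * (tilt ρ)⁻¹ * A⁻¹ * B = x * spin (ringAngle ρ σ ρ' σ') * (tilt σ)⁻¹ := by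
      rw [hB]
      group
    simp only [mul_inv_rev, inv_inv, map_inv]
    calc _ = x * (tilt ρ)⁻¹ * A⁻¹ *
          (A * (spin circleI)⁻¹ * tilt σ' * (spin (ringAngle ρ' σ' ρ σ))⁻¹) * y⁻¹ := by group
      _ = (x * (tilt ρ)⁻¹ * A⁻¹ * B) * spin circleI * tilt ρ' * y⁻¹ := by
          rw [h4]
          group
      _ = _ := by
          rw [h5]
          group)
  -- At even vertices `F` is a frame at the center; undoing the transport leaves only a spin, which
  -- fixes its first vector.
  refine ⟨F, fun v => origin (F v), fun v hv j hadj => ?_⟩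
  rw [hF v hv j hadj]
  simp only [mul_assoc, inv_mul_cancel, mul_one]
  rw [origin_mul_spin]

/-- Rings given by uniformizing variables build a pattern if and only if the variables satisfy the
ring equation at the internal vertices. -/
lemma build_iff_ringEquation (hP : IsSimplyConnectedComplex P) (hq : 0 < q) (hq' : q ≤ 1)
    (hβ : ∀ v ∈ evenVertices P, Uniformizes q (β v) (r v) (R v)) :
    BuildGeneralizedRingPattern P r R ↔
      ∀ v ∈ evenVertices P, IsInternal P v → RingEquation q β v := by
  rw [buildGeneralizedRingPattern_iff]
  exact ⟨fun ⟨_, _, h⟩ _ hv hint => ringEquation_of_isFramePattern hq hq' hβ h hv hint,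
    exists_isFramePattern hP hq hq' hβ⟩

end

/-! ### The parameter of a pattern -/

/-- Passing to the antipodal center changes the sign of both cosines, so the ratio lies in (0, 1)
for both descriptions. -/
lemma IsRing.cos_ratio {r R : ℝ} (h : IsRing r R) :
    Real.cos r ≠ 0 ∧ 0 < Real.cos R / Real.cos r ∧ Real.cos R / Real.cos r < 1 ∧
      |r| ≤ Real.pi ∧ 0 ≤ R ∧ R ≤ Real.pi := by
  have hpi := Real.pi_pos
  have hr := abs_nonneg r
  rw [← Real.cos_abs r]
  rcases h with ⟨h1, h2⟩ | ⟨h1, h2, h3⟩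
  · have c1 : 0 < Real.cos R := Real.cos_pos_of_mem_Ioo ⟨by linarith, h2⟩
    have c2 : Real.cos R < Real.cos |r| := Real.cos_lt_cos_of_nonneg_of_le_pi hr (by linarith) h1
    have c3 := c1.trans c2
    exact ⟨c3.ne', div_pos c1 c3, (div_lt_one c3).2 c2, by linarith, by linarith, by linarith⟩
  · have c1 : Real.cos R < 0 := Real.cos_neg_of_pi_div_two_lt_of_lt h1 (by linarith)
    have c2 : Real.cos |r| < Real.cos R := Real.cos_lt_cos_of_nonneg_of_le_pi (by linarith) h3 h2
    have c3 := c2.trans c1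
    exact ⟨c3.ne, div_pos_of_neg_of_neg c1 c3, (div_lt_one_of_neg c3).2 c2, h3, by linarith,
      by linarith⟩

lemma Neighboring.exists_sector {P : Set (ℤ × ℤ)} {v v' : ℤ × ℤ} (h : Neighboring P v v') :
    Even (v.1 + v.2) ∧ ∃ j, sector v j ∈ P ∧ v' = v + step j + step (j + 1) := by
  obtain ⟨hne, hv, hv', ⟨m, n⟩, hs, h1, h2⟩ := h
  refine ⟨hv, ?_⟩
  have : ∃ j, (m, n) = sector v j ∧ v' = v + step j + step (j + 1) := by
    simp only [corners, Set.mem_insert_iff, Set.mem_singleton_iff] at h1 h2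
    rcases h1 with rfl | rfl | rfl | rfl <;> rcases h2 with rfl | rfl | rfl | rfl <;>
      simp [Fin.exists_fin_succ, sector, step] at hne ⊢ <;> grind
  obtain ⟨j, hj, hj'⟩ := this
  exact ⟨j, hj ▸ hs, hj'⟩

lemma exists_modulus {P : Set (ℤ × ℤ)} (hP : IsSimplyConnectedComplex P) (hG : RingsConnected P)
    {r R : ℤ × ℤ → ℝ} (hring : ∀ v ∈ evenVertices P, IsRing (r v) (R v))
    (h : BuildGeneralizedRingPattern P r R) :
    ∃ q, 0 < q ∧ q < 1 ∧ ∀ v ∈ evenVertices P, q * Real.cos (r v) = Real.cos (R v) := by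
  obtain ⟨F, k, hF⟩ := (buildGeneralizedRingPattern_iff P r R).1 h
  have hne : ∃ u, u ∈ evenVertices P := by
    obtain ⟨v, hv⟩ := hP.1
    by_cases he : Even (v.1 + v.2)
    · exact ⟨v, hv, he⟩
    · obtain ⟨j, hj⟩ := exists_adj hv
      obtain ⟨⟨s, hs, -, h2⟩, -⟩ := hj
      exact ⟨v + step j, ⟨s, hs, h2⟩, (parity_step v j).2 (Int.not_even_iff_odd.1 he)⟩
  obtain ⟨u, hu⟩ := hne
  obtain ⟨hu0, hu1, hu2, -⟩ := (hring u hu).cos_ratio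
  -- q is the ratio cos R / cos r at the base ring `u`, carried along a chain of neighbors.
  refine ⟨_, hu1, hu2, fun v hv => ?_⟩
  have hchain := hG u hu v hv
  clear hv
  induction hchain with
  | refl => rw [div_mul_cancel₀ _ hu0]
  | tail _ hstep ih =>
    obtain ⟨hb, j, hj, rfl⟩ := hstep.exists_sector
    have hc := hF.cos_mul_cos hb hj
    rw [← ih] at hc
    have hb0 := (hring _ (mem_evenVertices_sector hb hj).1).cos_ratio.1
    apply mul_left_cancel₀ hb0
    rw [hc]
    ring

end

theorem mainTheorem4 (P : Set (ℤ × ℤ)) (hP : IsSimplyConnectedComplex P) (hG : RingsConnected P) :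
    (∀ r R : ℤ × ℤ → ℝ, (∀ v ∈ evenVertices P, IsRing (r v) (R v)) →
      (BuildGeneralizedRingPattern P r R ↔
        ∃ q : ℝ, 0 < q ∧ q < 1 ∧ ∃ β : ℤ × ℤ → ℝ,
          (∀ v ∈ evenVertices P,
            β v ∈ Set.Icc 0 (4 * ellipticK q) ∧ Uniformizes q (β v) (r v) (R v)) ∧
          ∀ v ∈ evenVertices P, IsInternal P v → RingEquation q β v)) ∧
    (∀ q : ℝ, 0 < q → q ≤ 1 → ∀ β r R : ℤ × ℤ → ℝ,
      (∀ v ∈ evenVertices P, Uniformizes q (β v) (r v) (R v)) →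
      (BuildGeneralizedRingPattern P r R ↔
        ∀ v ∈ evenVertices P, IsInternal P v → RingEquation q β v)) := by
  refine ⟨fun r R hring => ⟨fun h => ?_, ?_⟩, fun q hq hq' β r R hβ =>
    build_iff_ringEquation hP hq hq' hβ⟩
  · obtain ⟨q, hq, hq', hqv⟩ := exists_modulus hP hG hring h
    have hβ : ∀ v, ∃ b, v ∈ evenVertices P →
        b ∈ Set.Icc 0 (4 * ellipticK q) ∧ Uniformizes q b (r v) (R v) := by
      intro v
      by_cases hv : v ∈ evenVertices P
      · obtain ⟨-, -, -, h1, h2, h3⟩ := (hring v hv).cos_ratio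
        obtain ⟨b, hb, hb'⟩ := exists_uniformizing hq hq' h1 h2 h3 (hqv v hv)
        exact ⟨b, fun _ => ⟨hb, hb'⟩⟩
      · exact ⟨0, fun h => absurd h hv⟩
    choose β hβ using hβ
    exact ⟨q, hq, hq', β, hβ,
      (build_iff_ringEquation hP hq hq'.le fun v hv => (hβ v hv).2).1 h⟩
  · rintro ⟨q, hq, hq', β, hβ, heq⟩
    exact (build_iff_ringEquation hP hq hq'.le fun v hv => (hβ v hv).2).2 heq
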